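/- Let $\mathbb{R}_{\max}=\mathbb{R}\cup\{-\infty\}$ with $a\oplus b=\max(a,b)$, $a\otimes b=a+b$, and the induced matrix product $(A\otimes B)_{ij}=\max_l(A_{il}+B_{lj})$. For an integer $k\ge 1$ let $\mathcal{M}_k$ be the set of $k\times k$ matrices over $\mathbb{R}_{\max}$ with no row of $-\infty$, and let $\mathcal{P}_k$ be the set of primitive matrices, i.e. those $A\in\mathcal{M}_k$ some power $A^{\otimes n}$, $n\ge 1$, of which has only finite entries. A $k\times k$ matrix $A$ has rank $1$ if there are $a,b\in\mathbb{R}_{\max}^k\setminus\{(-\infty)^k\}$ with $A_{ij}=a_i+b_j$ for all $i,j$. A sequence $(A(n))_{n\in\mathbb{N}}$ of random matrices with values in $\mathcal{M}_k$ has the memory loss property (MLP) if there is an $N\ge 1$ such that $A(N)\otimes\cdots\otimes A(1)$ has rank $1$ with positive probability. For a finite set $Q$ and $\alpha\in\mathbb{R}^Q$, define the linear form $f_\alpha:\mathbb{R}_{\max}^Q\to\mathbb{R}_{\max}$ by $f_\alpha(V)=\sum_{\alpha_i\ne 0}\alpha_iV_i$ (usual operations) if $V_i\in\mathbb{R}$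 whenever $\alpha_i\neq 0$, and $f_\alpha(V)=-\infty$ otherwise. A hyperplane of $\mathbb{R}_{\max}^Q$ is a set $\{V: f_\alpha(V)=0\}$ with $\alpha\ne 0$. A hyperplane of $\mathcal{P}_k\times\mathcal{M}_k$ is the intersection of $\mathcal{P}_k\times\mathcal{M}_k$ with a hyperplane of $(\mathbb{R}_{\max}^{k\times k})^2$. **Theorem.** For every $k\ge 1$ there is a finite family of hyperplanes of $\mathcal{P}_k\times\mathcal{M}_k$ with the following two properties. 1. Its union contains every pair $(A,B)\in\mathcal{P}_k\times\mathcal{M}_k$ for which some sequence of i.i.d. random matrices with values in $\mathcal{M}_k$, taking each of the values $A$ and $B$ with positive probability, does not have the MLP. 2. For every pair $(A,B)\in\mathcal{P}_k\times\mathcal{M}_k$ outside this union, a stationary sequence $(A(n))_{n\in\mathbb{N}}$ of random matrices with values in $\mathcal{M}_k$ has the MLP, provided that $$\forall N\in\mathbb{N},\ \forall (A_i)_{i\in\{1,\dots,N\}}\in\{A,B\}^N,\quad \mathbb{P}\left[\forall i\in\{1,\dots,N\},\ A(i)=A_i\right]>0.$$ -/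

import Mathlib

open MeasureTheory ProbabilityTheory

universe u

namespace MaxPlus

/-- The max-plus semiring `ℝ ∪ {-∞}`: its sum is `⊔`, its product is `+`, and `⊥` is `-∞`. -/
abbrev Rmax : Type := WithBot ℝ

/-- The Borel `σ`-algebra of the order topology of `[-∞, ∞)`. -/
instance : MeasurableSpace Rmax := borel Rmax

/-- Square matrices of size `k` with entries in `Rmax`. They carry the product `σ`-algebra. -/
abbrev Mat (k : ℕ) : Type := Fin k → Fin k → Rmax

/-- The max-plus product, `(A ⊗ B) i j = max_l (A i l + B l j)`. -/
noncomputable def mul {k : ℕ} (A B : Mat k) : Mat k :=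
  fun i j => Finset.univ.sup fun l => A i l + B l j

/-- The max-plus identity matrix: `0` on the diagonal and `-∞` elsewhere. -/
noncomputable def one (k : ℕ) : Mat k :=
  fun i j => if i = j then 0 else ⊥

/-- The max-plus power `A ⊗ ⋯ ⊗ A` (`n` factors). -/
noncomputable def pow {k : ℕ} (A : Mat k) : ℕ → Mat k
  | 0 => one k
  | n + 1 => mul A (pow A n)

/-- The backward product `A(n) ⊗ ⋯ ⊗ A(1)` of a sequence of matrices. -/
noncomputable def backProd {k : ℕ} (A : ℕ → Mat k) : ℕ → Mat k
  | 0 => one k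
  | n + 1 => mul (A (n + 1)) (backProd A n)

/-- The set of matrices without a row of `-∞`. -/
def NoBotRow (k : ℕ) : Set (Mat k) :=
  {A | ∀ i, ∃ j, A i j ≠ ⊥}

/-- The set of primitive matrices: no row of `-∞`, and some power has only finite entries. -/
def Primitive (k : ℕ) : Set (Mat k) :=
  {A | A ∈ NoBotRow k ∧ ∃ n : ℕ, 1 ≤ n ∧ ∀ i j, pow A n i j ≠ ⊥}

/-- Max-plus rank one: `A i j = a i + b j` for two vectors that are not identically `-∞`. -/
def IsRankOne {k : ℕ} (A : Mat k) : Prop :=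
  ∃ a b : Fin k → Rmax, a ≠ (fun _ => ⊥) ∧ b ≠ (fun _ => ⊥) ∧ ∀ i j, A i j = a i + b j

/-- The linear form on `Rmax ^ Q` with real coefficients `α`: the usual sum `∑ α i * V i` over the
`i` with `α i ≠ 0` if all the `V i` that occur are finite, and `-∞` otherwise. -/
noncomputable def linForm {Q : Type} [Fintype Q] (α : Q → ℝ) (V : Q → Rmax) : Rmax :=
  open Classical in
  if ∀ i, α i ≠ 0 → V i ≠ ⊥ then
    ((∑ i with α i ≠ 0, α i * (V i).unbotD 0 : ℝ) : Rmax)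
  else ⊥

/-- A hyperplane of `Rmax ^ Q`: the set of zeros of a non-zero linear form. -/
def IsHyperplane {Q : Type} [Fintype Q] (H : Set (Q → Rmax)) : Prop :=
  ∃ α : Q → ℝ, α ≠ 0 ∧ H = {V | linForm α V = 0}

/-- A pair of matrices as the family of all its entries. -/
def pairEntries {k : ℕ} (p : Mat k × Mat k) : (Fin k × Fin k) ⊕ (Fin k × Fin k) → Rmax :=
  Sum.elim (fun q => p.1 q.1 q.2) (fun q => p.2 q.1 q.2)

/-- A hyperplane of the set of pairs (primitive matrix, matrix without a row of `-∞`): the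
intersection with this set of a hyperplane of the space of all pairs of matrices. -/
def IsPairHyperplane (k : ℕ) (H : Set (Mat k × Mat k)) : Prop :=
  ∃ H' : Set ((Fin k × Fin k) ⊕ (Fin k × Fin k) → Rmax), IsHyperplane H' ∧
    H = (pairEntries ⁻¹' H') ∩ (Primitive k ×ˢ NoBotRow k)

section Random

variable {Ω : Type u} [MeasurableSpace Ω] {k : ℕ}

/-- A sequence of random matrices that almost surely have no row of `-∞`. -/
structure IsRandomSeq (X : ℕ → Ω → Mat k) (P : Measure Ω) : Prop where
  aemeasurable : ∀ n, AEMeasurable (X n) P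
  noBotRow : ∀ n, ∀ᵐ ω ∂P, X n ω ∈ NoBotRow k

/-- Independent, identically distributed random matrices. -/
structure IsIIDSeq (X : ℕ → Ω → Mat k) (P : Measure Ω) : Prop extends IsRandomSeq X P where
  indep : iIndepFun X P
  identDistrib : ∀ n, IdentDistrib (X n) (X 0) P P

/-- Stationarity: the shifted sequence has the same law as the sequence itself. -/
structure IsStationarySeq (X : ℕ → Ω → Mat k) (P : Measure Ω) : Prop
    extends IsRandomSeq X P where
  shift : IdentDistrib (fun ω n => X (n + 1) ω) (fun ω n => X n ω) P P

/-- The memory loss property: with positive probability `X(N) ⊗ ⋯ ⊗ X(1)` has rank one, for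
some `N`. -/
def HasMLP (X : ℕ → Ω → Mat k) (P : Measure Ω) : Prop :=
  ∃ N : ℕ, 1 ≤ N ∧ 0 < P {ω | IsRankOne (backProd (fun n => X n ω) N)}

end Random

end MaxPlus

/-!
# Rank-one words in generic pairs of max-plus matrices

The exceptional hyperplanes are those given by the non-zero linear forms with *integer*
coefficients of absolute value at most `8 * k ^ 2`. There are finitely many of them, and for a pair
`(A, B)` outside their union the finite entries of `A` and `B` satisfy no small integer relation
(`GenericPair`). The point is that such a pair has a word in `A` and `B` of rank one
(`exists_word_isRankOne`); a sequence that spells this word with positive probability has the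
memory loss property.

Let `lam` be the maximal mean weight of a short closed walk of `A`. By genericity it is attained by
a single simple cycle `γ` (`exists_cycle`, `isEdge_of_critical`). Hence the other closed walks stay
subcritical after a small increase of the entries off `γ`, and a potential turns `A - lam` into a
matrix that is `0` along `γ` and negative elsewhere (`exists_isNormalForm`). Let `A` be in this
form. An optimal walk among all long walks of a given length to a vertex `j` follows `γ` and leaves
it only for a short final piece (`IsNormalForm.exists_tail`). Two optimal walks give an integer
relation between the entries of the original matrix, so that genericity forces their final pieces to
use the same edges. These determine the starting point of the walk. So each column of a high power
`A ^ a` has its maximum in a single row, on `γ` (`IsNormalForm.exists_column_max`); by transposition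
the same holds for the rows.

It follows that the largest entry of `A ^ a ⊗ B ⊗ A ^ b` is attained only once, at a pair of
vertices of `γ`: two optimal paths that cross `B` at different entries would give another small
relation (`IsNormalForm.exists_uniqueMax`). Multiplication by `A` rotates the row of this entry
along `γ` and so moves it to the diagonal (`HasUniqueMax.mul_left`). A finite matrix with a unique
largest entry on the diagonal has powers of rank one, since long optimal walks pass through the
corresponding loop (`exists_pow_isRankOne`).
-/

namespace MaxPlus

variable {k : ℕ}

/-! ### Max-plus matrix algebra -/

theorem le_mul (A B : Mat k) (i l j : Fin k) : A i l + B l j ≤ mul A B i j :=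
  Finset.le_sup (f := fun l => A i l + B l j) (Finset.mem_univ l)

theorem mul_le_iff {A B : Mat k} {i j : Fin k} {x : Rmax} :
    mul A B i j ≤ x ↔ ∀ l, A i l + B l j ≤ x := by
  simp [mul]

theorem exists_mul_eq (A B : Mat k) (i j : Fin k) : ∃ l, mul A B i j = A i l + B l j := by
  obtain ⟨l, -, hl⟩ := Finset.exists_mem_eq_sup Finset.univ ⟨i, Finset.mem_univ i⟩
    (fun l => A i l + B l j)
  exact ⟨l, hl⟩

theorem maxMul_assoc (A B C : Mat k) : mul (mul A B) C = mul A (mul B C) := by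
  funext i j
  apply le_antisymm
  · rw [mul_le_iff]
    intro l
    obtain ⟨m, hm⟩ := exists_mul_eq A B i l
    rw [hm, add_assoc]
    exact (add_le_add le_rfl (le_mul B C m l j)).trans (le_mul A _ i m j)
  · rw [mul_le_iff]
    intro l
    obtain ⟨m, hm⟩ := exists_mul_eq B C l j
    rw [hm, ← add_assoc]
    exact (add_le_add (le_mul A B i l m) le_rfl).trans (le_mul _ C i m j)

theorem one_maxMul (A : Mat k) : mul (one k) A = A := by
  funext i j
  apply le_antisymm
  · rw [mul_le_iff]
    intro l
    by_cases h : i = l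
    · subst h; simp [one]
    · simp [one, h]
  · simpa [one] using le_mul (one k) A i i j

theorem maxMul_one (A : Mat k) : mul A (one k) = A := by
  funext i j
  apply le_antisymm
  · rw [mul_le_iff]
    intro l
    by_cases h : l = j
    · subst h; simp [one]
    · simp [one, h]
  · simpa [one] using le_mul A (one k) i j j

theorem maxPow_add (A : Mat k) (m n : ℕ) : pow A (m + n) = mul (pow A m) (pow A n) := by
  induction m with
  | zero => rw [Nat.zero_add, pow, one_maxMul]
  | succ m ih => rw [Nat.succ_add, pow, pow, ih, maxMul_assoc]

theorem maxPow_one (A : Mat k) : pow A 1 = A := by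
  rw [pow, pow, maxMul_one]

theorem pow_add_le (A : Mat k) (m n : ℕ) (i l j : Fin k) :
    pow A m i l + pow A n l j ≤ pow A (m + n) i j := by
  rw [maxPow_add]
  exact le_mul _ _ _ _ _

/-- The transpose of a matrix. -/
def tr (A : Mat k) : Mat k := fun i j => A j i

theorem mul_tr (A B : Mat k) : mul (tr A) (tr B) = tr (mul B A) := by
  funext i j
  simp only [mul, tr, add_comm]

theorem one_tr : tr (one k) = one k := by
  funext i j
  simp only [tr, one, eq_comm]

theorem pow_tr (A : Mat k) (n : ℕ) : pow (tr A) n = tr (pow A n) := by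
  induction n with
  | zero => rw [pow, pow, one_tr]
  | succ n ih => rw [pow, ih, mul_tr, maxPow_add, maxPow_one]

/-- Every entry of the matrix is finite. -/
def IsFin (A : Mat k) : Prop := ∀ i j, A i j ≠ ⊥

theorem isFin_mul {A B : Mat k} (hA : A ∈ NoBotRow k) (hB : IsFin B) : IsFin (mul A B) := by
  intro i j
  obtain ⟨l, hl⟩ := hA i
  refine ne_bot_of_le_ne_bot ?_ (le_mul A B i l j)
  simp [WithBot.add_eq_bot, hl, hB l j]

theorem IsFin.noBotRow {A : Mat k} (hA : IsFin A) : A ∈ NoBotRow k := fun i => ⟨i, hA i i⟩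

theorem isFin_pow_of_le {A : Mat k} (hA : A ∈ NoBotRow k) {n m : ℕ} (hn : IsFin (pow A n))
    (h : n ≤ m) : IsFin (pow A m) := by
  induction m, h using Nat.le_induction with
  | base => exact hn
  | succ m _ ih => exact isFin_mul hA ih

/-- Diagonal conjugation by the potential `h`, together with a shift by `μ`: the entry `A i j`
becomes `A i j + μ + h j - h i`. -/
noncomputable def scale (μ : ℝ) (h : Fin k → ℝ) (A : Mat k) : Mat k :=
  fun i j => A i j + ((μ + h j - h i : ℝ) : Rmax)

theorem scale_eq_bot {μ : ℝ} {h : Fin k → ℝ} {A : Mat k} {i j : Fin k} :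
    scale μ h A i j = ⊥ ↔ A i j = ⊥ := by
  simp [scale, WithBot.add_eq_bot]

theorem mul_scale (μ ν : ℝ) (h : Fin k → ℝ) (A B : Mat k) :
    mul (scale μ h A) (scale ν h B) = scale (μ + ν) h (mul A B) := by
  have key : ∀ i l j : Fin k, scale μ h A i l + scale ν h B l j =
      (A i l + B l j) + ((μ + ν + h j - h i : ℝ) : Rmax) := by
    intro i l j
    have : (μ + ν + h j - h i : ℝ) = (μ + h l - h i) + (ν + h j - h l) := by ring
    rw [this, WithBot.coe_add, scale, scale, add_add_add_comm]
  funext i j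
  apply le_antisymm
  · rw [mul_le_iff]
    intro l
    rw [key]
    exact add_le_add (le_mul A B i l j) le_rfl
  · obtain ⟨l, hl⟩ := exists_mul_eq A B i j
    rw [scale, hl, ← key]
    exact le_mul _ _ _ _ _

theorem scale_one (h : Fin k → ℝ) : scale 0 h (one k) = one k := by
  funext i j
  by_cases hij : i = j
  · subst hij; simp [scale, one]
  · simp [scale, one, hij]

theorem pow_scale (μ : ℝ) (h : Fin k → ℝ) (A : Mat k) (n : ℕ) :
    pow (scale μ h A) n = scale (n * μ) h (pow A n) := by
  induction n with
  | zero => simp [pow, scale_one]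
  | succ n ih =>
    rw [pow, ih, mul_scale, pow]
    congr 1
    push_cast
    ring

theorem isFin_scale {μ : ℝ} {h : Fin k → ℝ} {A : Mat k} : IsFin (scale μ h A) ↔ IsFin A := by
  simp only [IsFin, ne_eq, scale_eq_bot]

theorem noBotRow_scale {μ : ℝ} {h : Fin k → ℝ} {A : Mat k} (hA : A ∈ NoBotRow k) :
    scale μ h A ∈ NoBotRow k := by
  intro i
  obtain ⟨j, hj⟩ := hA i
  exact ⟨j, by rwa [ne_eq, scale_eq_bot]⟩

theorem isRankOne_of_scale {μ : ℝ} {h : Fin k → ℝ} {A : Mat k} (hA : IsRankOne (scale μ h A)) :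
    IsRankOne A := by
  obtain ⟨a, b, ha, hb, hab⟩ := hA
  refine ⟨fun i => a i + ((h i - μ : ℝ) : Rmax), fun j => b j + ((-h j : ℝ) : Rmax), ?_, ?_, ?_⟩
  · intro h0
    apply ha
    funext i
    simpa [WithBot.add_eq_bot] using congrFun h0 i
  · intro h0
    apply hb
    funext i
    simpa [WithBot.add_eq_bot] using congrFun h0 i
  · intro i j
    have h1 := hab i j
    rw [add_add_add_comm, ← h1, scale, add_assoc, ← WithBot.coe_add, ← WithBot.coe_add]
    have : (μ + h j - h i + (h i - μ + -h j) : ℝ) = 0 := by ring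
    rw [this, WithBot.coe_zero, add_zero]

/-! ### Words in two matrices -/

theorem backProd_congr {v w : ℕ → Mat k} {N : ℕ} (h : ∀ i ∈ Finset.Icc 1 N, v i = w i) :
    backProd v N = backProd w N := by
  induction N with
  | zero => rfl
  | succ N ih =>
    rw [backProd, backProd, h (N + 1) (by simp), ih]
    intro i hi
    rw [Finset.mem_Icc] at hi
    exact h i (by rw [Finset.mem_Icc]; omega)

theorem backProd_append (v w : ℕ → Mat k) (M N : ℕ) :
    backProd (fun i => if i ≤ N then w i else v (i - N)) (N + M) =
      mul (backProd v M) (backProd w N) := by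
  induction M with
  | zero =>
    rw [backProd, one_maxMul]
    refine backProd_congr fun i hi => ?_
    exact if_pos (Finset.mem_Icc.1 hi).2
  | succ M ih =>
    rw [← Nat.add_assoc, backProd, ih, backProd, maxMul_assoc]
    congr 1
    rw [if_neg (by omega)]
    congr 1
    omega

/-- `M` is, up to diagonal conjugation by `h` and a shift, the product of a non-empty word in the
letters `A` and `B`. -/
def IsWord (A B : Mat k) (h : Fin k → ℝ) (M : Mat k) : Prop :=
  ∃ (N : ℕ) (w : ℕ → Mat k) (μ : ℝ), 1 ≤ N ∧ (∀ i, w i = A ∨ w i = B) ∧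
    M = scale μ h (backProd w N)

theorem isWord_left (A B : Mat k) (h : Fin k → ℝ) (μ : ℝ) : IsWord A B h (scale μ h A) :=
  ⟨1, fun _ => A, μ, le_rfl, fun _ => Or.inl rfl, by rw [backProd, backProd, maxMul_one]⟩

theorem isWord_right (A B : Mat k) (h : Fin k → ℝ) (μ : ℝ) : IsWord A B h (scale μ h B) :=
  ⟨1, fun _ => B, μ, le_rfl, fun _ => Or.inr rfl, by rw [backProd, backProd, maxMul_one]⟩

theorem IsWord.mul {A B : Mat k} {h : Fin k → ℝ} {M M' : Mat k} (hM : IsWord A B h M)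
    (hM' : IsWord A B h M') : IsWord A B h (mul M M') := by
  obtain ⟨m, v, μ, hm, hv, rfl⟩ := hM
  obtain ⟨n, w, ν, hn, hw, rfl⟩ := hM'
  refine ⟨n + m, _, μ + ν, by omega, ?_, by rw [mul_scale, ← backProd_append]⟩
  intro i
  by_cases hi : i ≤ n
  · simpa [hi] using hw i
  · simpa [hi] using hv _

theorem IsWord.pow {A B : Mat k} {h : Fin k → ℝ} {M : Mat k} (hM : IsWord A B h M) {n : ℕ}
    (hn : 1 ≤ n) : IsWord A B h (pow M n) := by
  induction n, hn using Nat.le_induction with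
  | base => rwa [maxPow_one]
  | succ n _ ih => exact hM.mul ih

/-! ### Powers of a matrix with a dominating loop -/

/-- The negative members of a finite family are bounded away from `0`. -/
theorem exists_gap {ι : Type*} [Finite ι] (f : ι → Rmax) :
    ∃ ε : ℝ, 0 < ε ∧ ∀ i, f i < 0 → f i ≤ ((-ε : ℝ) : Rmax) := by
  classical
  have := Fintype.ofFinite ι
  have key : ∀ s : Finset ι,
      ∃ ε : ℝ, 0 < ε ∧ ∀ i ∈ s, f i < 0 → f i ≤ ((-ε : ℝ) : Rmax) := by
    intro s
    induction s using Finset.induction_on with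
    | empty => exact ⟨1, one_pos, by simp⟩
    | insert a s _ ih =>
      obtain ⟨ε, hε, h⟩ := ih
      have h1 : ∃ δ : ℝ, 0 < δ ∧ (f a < 0 → f a ≤ ((-δ : ℝ) : Rmax)) := by
        induction hfa : f a using WithBot.recBotCoe with
        | bot => exact ⟨1, one_pos, fun _ => bot_le⟩
        | coe x =>
          by_cases hx : x < 0
          · exact ⟨-x, by linarith, fun _ => by simp⟩
          · exact ⟨1, one_pos, fun h0 => absurd (WithBot.coe_lt_coe.1 h0) hx⟩
      obtain ⟨δ, hδ, h2⟩ := h1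
      refine ⟨min ε δ, lt_min hε hδ, fun i hi h0 => ?_⟩
      rcases Finset.mem_insert.1 hi with rfl | hi
      · exact (h2 h0).trans (WithBot.coe_le_coe.2 (neg_le_neg (min_le_right _ _)))
      · exact (h i hi h0).trans (WithBot.coe_le_coe.2 (neg_le_neg (min_le_left _ _)))
  obtain ⟨ε, hε, h⟩ := key Finset.univ
  exact ⟨ε, hε, fun i => h i (Finset.mem_univ i)⟩

theorem exists_lower_bound {ι : Type*} [Finite ι] (f : ι → Rmax) (hf : ∀ i, f i ≠ ⊥) :
    ∃ T : ℝ, 0 ≤ T ∧ ∀ i, ((-T : ℝ) : Rmax) ≤ f i := by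
  have := Fintype.ofFinite ι
  refine ⟨∑ i, |(f i).unbot (hf i)|, Finset.sum_nonneg fun i _ => abs_nonneg _, fun i => ?_⟩
  rw [← WithBot.coe_unbot (f i) (hf i), WithBot.coe_le_coe]
  have h1 := Finset.single_le_sum (f := fun i => |(f i).unbot (hf i)|)
    (fun i _ => abs_nonneg _) (Finset.mem_univ i)
  have h2 := neg_abs_le ((f i).unbot (hf i))
  linarith

theorem pow_nonpos {E : Mat k} (hE : ∀ i j, E i j ≤ 0) (n : ℕ) (i j : Fin k) :
    pow E n i j ≤ 0 := by
  induction n generalizing i j with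
  | zero => simp only [pow, one]; split_ifs <;> simp
  | succ n ih =>
    rw [pow, mul_le_iff]
    intro l
    simpa using add_le_add (hE i l) (ih l j)

theorem pow_le_pow_succ_col {E : Mat k} {c : Fin k} (hc : E c c = 0) (n : ℕ) (i : Fin k) :
    pow E n i c ≤ pow E (n + 1) i c := by
  have := pow_add_le E n 1 i c c
  rwa [maxPow_one, hc, add_zero] at this

theorem pow_le_pow_succ_row {E : Mat k} {c : Fin k} (hc : E c c = 0) (n : ℕ) (j : Fin k) :
    pow E n c j ≤ pow E (n + 1) c j := by
  have := le_mul E (pow E n) c c j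
  rwa [hc, zero_add] at this

theorem pow_loop {E : Mat k} (hE : ∀ i j, E i j ≤ 0) {c : Fin k} (hc : E c c = 0) (n : ℕ) :
    pow E n c c = 0 := by
  refine le_antisymm (pow_nonpos hE n c c) ?_
  induction n with
  | zero => simp [pow, one]
  | succ n ih => exact ih.trans (pow_le_pow_succ_col hc n c)

/-- A walk of length `n + 1` to `c` either stays at `c` in its last step or has paid `ε` at every
step. -/
theorem pow_succ_col_le {E : Mat k} (hE : ∀ i j, E i j ≤ 0) {c : Fin k} (hc : E c c = 0) {ε : ℝ}
    (hε : ∀ i j, (i = c ∧ j = c) ∨ E i j ≤ ((-ε : ℝ) : Rmax)) (n : ℕ) (i : Fin k) :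
    pow E (n + 1) i c ≤ max (pow E n i c) ((-(ε * (n + 1 : ℕ)) : ℝ) : Rmax) := by
  induction n generalizing i with
  | zero =>
    rw [zero_add, maxPow_one]
    rcases hε i c with ⟨rfl, -⟩ | h
    · rw [hc, pow_loop hE hc]
      exact le_max_left _ _
    · refine h.trans (le_max_of_le_right ?_)
      simp
  | succ n ih =>
    rw [pow, mul_le_iff]
    intro l
    rcases hε i l with ⟨rfl, rfl⟩ | h
    · rw [hc, zero_add, pow_loop hE hc]
      exact le_max_left _ _
    · refine (add_le_add le_rfl (ih l)).trans ?_
      rw [← max_add_add_left]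
      refine max_le_max (le_mul E (pow E n) i l c) ((add_le_add h le_rfl).trans ?_)
      rw [← WithBot.coe_add, WithBot.coe_le_coe]
      push_cast
      linarith

/-- A walk either passes through `c` or has paid `ε` at every step. -/
theorem pow_le_max {E : Mat k} (hE : ∀ i j, E i j ≤ 0) {c : Fin k} (hc : E c c = 0) {ε : ℝ}
    (hε : ∀ i j, (i = c ∧ j = c) ∨ E i j ≤ ((-ε : ℝ) : Rmax)) (n : ℕ) (i j : Fin k) :
    pow E n i j ≤ max (pow E n i c + pow E n c j) ((-(ε * n) : ℝ) : Rmax) := by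
  induction n generalizing i with
  | zero =>
    refine le_max_of_le_right ?_
    simpa using pow_nonpos hE 0 i j
  | succ n ih =>
    rw [pow, mul_le_iff]
    intro l
    rcases hε i l with ⟨hi, hl⟩ | h
    · refine le_max_of_le_left ?_
      change _ ≤ pow E (n + 1) i c + pow E (n + 1) c j
      rw [hi, hl, hc, zero_add, pow_loop hE hc, zero_add]
      exact pow_le_pow_succ_row hc n j
    · refine (add_le_add le_rfl (ih l)).trans ?_
      rw [← max_add_add_left, ← add_assoc]
      refine max_le_max (add_le_add (le_mul E (pow E n) i l c) (pow_le_pow_succ_row hc n j))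
        ((add_le_add h le_rfl).trans ?_)
      rw [← WithBot.coe_add, WithBot.coe_le_coe]
      push_cast
      linarith

/-- The entries of the column of `c` no longer change once a walk that avoids `c` costs more than
any single edge. -/
theorem col_stable {E : Mat k} (hE : ∀ i j, E i j ≤ 0) {c : Fin k} (hc : E c c = 0) {ε T : ℝ}
    (hε0 : 0 < ε) (hε : ∀ i j, (i = c ∧ j = c) ∨ E i j ≤ ((-ε : ℝ) : Rmax))
    (hT : ∀ i j, ((-T : ℝ) : Rmax) ≤ E i j) {m n : ℕ} (hm : 1 ≤ m) (hmT : T ≤ ε * m)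
    (hmn : m ≤ n) (i : Fin k) : pow E n i c = pow E m i c := by
  induction n, hmn using Nat.le_induction with
  | base => rfl
  | succ n hn ih =>
    refine le_antisymm ?_ (ih ▸ pow_le_pow_succ_col hc n i)
    have hlow : ∀ r, 1 ≤ r → E i c ≤ pow E r i c := by
      intro r hr
      induction r, hr using Nat.le_induction with
      | base => rw [maxPow_one]
      | succ r _ ihr => exact ihr.trans (pow_le_pow_succ_col hc r i)
    rw [← ih]
    refine (pow_succ_col_le hE hc hε n i).trans (max_le le_rfl ?_)
    refine le_trans ?_ ((hT i c).trans (hlow n (hm.trans hn)))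
    rw [WithBot.coe_le_coe]
    have : (m : ℝ) ≤ (n + 1 : ℕ) := by exact_mod_cast hn.trans (Nat.le_succ n)
    nlinarith

/-- If the largest entry of a finite matrix is attained at a single place, and this place is on
the diagonal, then the high powers have rank one: all optimal long walks use the loop. -/
theorem exists_pow_isRankOne {E : Mat k} (hfin : IsFin E) {c : Fin k} (hc : E c c = 0)
    (hlt : ∀ i j, (i = c ∧ j = c) ∨ E i j < 0) : ∃ n, 1 ≤ n ∧ IsRankOne (pow E n) := by
  have hE : ∀ i j, E i j ≤ 0 := by
    intro i j
    rcases hlt i j with ⟨rfl, rfl⟩ | h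
    · exact hc.le
    · exact h.le
  obtain ⟨ε, hε0, hε⟩ := exists_gap (fun q : Fin k × Fin k => E q.1 q.2)
  replace hε : ∀ i j, (i = c ∧ j = c) ∨ E i j ≤ ((-ε : ℝ) : Rmax) := fun i j =>
    (hlt i j).imp id fun h => hε (i, j) h
  obtain ⟨T, hT0, hT⟩ := exists_lower_bound (fun q : Fin k × Fin k => E q.1 q.2)
    fun q => hfin q.1 q.2
  replace hT : ∀ i j, ((-T : ℝ) : Rmax) ≤ E i j := fun i j => hT (i, j)
  obtain ⟨m, hm⟩ := exists_nat_ge (2 * T / ε + 1)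
  have hm1 : 1 ≤ m := by
    have h1 := div_nonneg (mul_nonneg zero_le_two hT0) hε0.le
    have h2 : (1 : ℝ) ≤ m := by linarith
    exact_mod_cast h2
  have hmT : 2 * T ≤ ε * m := by
    have : 2 * T / ε ≤ m := by linarith
    rw [div_le_iff₀ hε0] at this
    linarith
  have hcol : ∀ n, m ≤ n → ∀ i, pow E n i c = pow E m i c := fun n hn i =>
    col_stable hE hc hε0 hε hT hm1 (by linarith) hn i
  have hrow : ∀ n, m ≤ n → ∀ j, pow E n c j = pow E m c j := by
    intro n hn j
    have := col_stable (E := tr E) (fun i j => hE j i) (c := c) hc hε0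
      (fun i j => (hε j i).imp And.symm id) (fun i j => hT j i) hm1 (by linarith) hn j
    rwa [pow_tr, pow_tr] at this
  have hpf : ∀ n, 1 ≤ n → IsFin (pow E n) := fun n hn =>
    isFin_pow_of_le hfin.noBotRow (n := 1) (by rwa [maxPow_one]) hn
  have hne : ∀ v : Fin k → Rmax, v c ≠ ⊥ → v ≠ fun _ => ⊥ := fun v hv h => hv (congrFun h c)
  refine ⟨m + m, by omega, fun i => pow E m i c, fun j => pow E m c j, hne _ (hpf m hm1 _ _),
    hne _ (hpf m hm1 _ _), fun i j => le_antisymm ?_ (pow_add_le E m m i c j)⟩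
  refine (pow_le_max hE hc hε (m + m) i j).trans (max_le ?_ ?_)
  · rw [hcol _ (by omega), hrow _ (by omega)]
  · have hlowc : E i c ≤ pow E (m + m) i c := by
      rw [hcol _ (by omega), ← hcol (m + 1) (by omega)]
      have := pow_add_le E 1 m i c c
      rwa [pow_loop hE hc, add_zero, maxPow_one, add_comm] at this
    have hlowr : E c j ≤ pow E (m + m) c j := by
      rw [hrow _ (by omega), ← hrow (m + 1) (by omega)]
      have := pow_add_le E m 1 c c j
      rwa [pow_loop hE hc, zero_add, maxPow_one] at this
    rw [hcol _ (by omega)] at hlowc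
    rw [hrow _ (by omega)] at hlowr
    refine le_trans ?_ (add_le_add ((hT i c).trans hlowc) ((hT c j).trans hlowr))
    rw [← WithBot.coe_add, WithBot.coe_le_coe]
    push_cast
    nlinarith

/-! ### Walks, their weights and their edge counts -/

/-- The weight in `A` of the first `n` steps of the walk `g`; it is `-∞` if one of these steps is
not an edge of `A`. -/
noncomputable def walkWeight (A : Mat k) (g : ℕ → Fin k) (n : ℕ) : Rmax :=
  ∑ t ∈ Finset.range n, A (g t) (g (t + 1))

/-- The real value of an entry, `0` if the entry is `-∞`. -/
noncomputable def entry (A : Mat k) (e : Fin k × Fin k) : ℝ := (A e.1 e.2).unbotD 0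

/-- The number of times the first `n` steps of the walk `g` use the edge `e`. -/
def edgeCount (g : ℕ → Fin k) (n : ℕ) (e : Fin k × Fin k) : ℤ :=
  ∑ t ∈ Finset.range n, if (g t, g (t + 1)) = e then 1 else 0

theorem walkWeight_add (A : Mat k) (g : ℕ → Fin k) (m n : ℕ) :
    walkWeight A g (m + n) = walkWeight A g m + walkWeight A (fun t => g (m + t)) n := by
  simp only [walkWeight, Finset.sum_range_add, Nat.add_assoc]

theorem walkWeight_le_pow (A : Mat k) (g : ℕ → Fin k) (n : ℕ) :
    walkWeight A g n ≤ pow A n (g 0) (g n) := by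
  induction n with
  | zero => simp [walkWeight, pow, one]
  | succ n ih =>
    have h := pow_add_le A n 1 (g 0) (g n) (g (n + 1))
    rw [maxPow_one] at h
    rw [walkWeight, Finset.sum_range_succ]
    exact (add_le_add ih le_rfl).trans h

theorem walkWeight_window_le_pow (A : Mat k) (g : ℕ → Fin k) (m n : ℕ) :
    walkWeight A (fun t => g (m + t)) n ≤ pow A n (g m) (g (m + n)) :=
  walkWeight_le_pow A (fun t => g (m + t)) n

theorem exists_walk (A : Mat k) (n : ℕ) (i j : Fin k) (h : pow A n i j ≠ ⊥) :
    ∃ g : ℕ → Fin k, g 0 = i ∧ g n = j ∧ walkWeight A g n = pow A n i j := by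
  induction n generalizing i with
  | zero =>
    by_cases hij : i = j
    · exact ⟨fun _ => i, rfl, hij, by simp [walkWeight, pow, one, hij]⟩
    · simp [pow, one, hij] at h
  | succ n ih =>
    obtain ⟨l, hl⟩ := exists_mul_eq A (pow A n) i j
    rw [pow, hl] at h
    obtain ⟨g, hg0, hgn, hg⟩ := ih l fun h0 => h (by rw [h0, WithBot.add_bot])
    refine ⟨fun t => Nat.casesOn t i g, rfl, hgn, ?_⟩
    rw [pow, hl, walkWeight, Finset.sum_range_succ', add_comm, ← hg]
    simp only [walkWeight]
    change A i (g 0) + _ = _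
    rw [hg0]

theorem exists_repeat (g : ℕ → Fin k) : ∃ u v, u < v ∧ v ≤ k ∧ g u = g v := by
  obtain ⟨x, y, hxy, h⟩ := Fintype.exists_ne_map_eq_of_card_lt
    (fun x : Fin (k + 1) => g x) (by simp)
  rcases lt_or_gt_of_ne hxy with h1 | h1
  · exact ⟨x, y, h1, Nat.lt_succ_iff.1 y.2, h⟩
  · exact ⟨y, x, h1, Nat.lt_succ_iff.1 x.2, h.symm⟩

/-- A walk of at least `k` steps contains a closed walk of at most `k` steps, which can be cut
out. -/
theorem exists_cycle_cut (A : Mat k) (g : ℕ → Fin k) {n : ℕ} (hn : k ≤ n) :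
    ∃ (u r : ℕ) (x : Rmax), r + 1 ≤ k ∧ u + (r + 1) ≤ n ∧ g u = g (u + (r + 1)) ∧
      walkWeight A g n = x + walkWeight A (fun t => g (u + t)) (r + 1) ∧
      x ≤ pow A (n - (r + 1)) (g 0) (g n) := by
  obtain ⟨u, v, huv, hvk, hguv⟩ := exists_repeat g
  obtain ⟨r, rfl⟩ := Nat.exists_eq_add_of_lt huv
  obtain ⟨s, rfl⟩ := Nat.exists_eq_add_of_le (hvk.trans hn)
  refine ⟨u, r, walkWeight A g u + walkWeight A (fun t => g (u + (r + 1) + t)) s,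
    by omega, by omega, hguv, ?_, ?_⟩
  · rw [Nat.add_assoc u r 1, walkWeight_add, walkWeight_add, add_right_comm]
  · have h3 := walkWeight_window_le_pow A g (u + (r + 1)) s
    rw [← Nat.add_assoc u r 1, ← hguv] at h3
    have : u + r + 1 + s - (r + 1) = u + s := by omega
    rw [this]
    exact (add_le_add (walkWeight_le_pow A g u) h3).trans (pow_add_le A u s _ _ _)

theorem walkWeight_ne_bot {A : Mat k} {g : ℕ → Fin k} {n : ℕ} :
    walkWeight A g n ≠ ⊥ ↔ ∀ t, t < n → A (g t) (g (t + 1)) ≠ ⊥ := by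
  simp [walkWeight, WithBot.sum_eq_bot_iff]

theorem coe_entry {A : Mat k} {i j : Fin k} (h : A i j ≠ ⊥) : (entry A (i, j) : Rmax) = A i j := by
  obtain ⟨x, hx⟩ := WithBot.ne_bot_iff_exists.1 h
  simp [entry, ← hx]

theorem walkWeight_eq_coe {A : Mat k} {g : ℕ → Fin k} {n : ℕ} (h : walkWeight A g n ≠ ⊥) :
    walkWeight A g n = ((∑ t ∈ Finset.range n, entry A (g t, g (t + 1)) : ℝ) : Rmax) := by
  rw [walkWeight_ne_bot] at h
  rw [walkWeight, WithBot.coe_sum]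
  exact Finset.sum_congr rfl fun t ht => (coe_entry (h t (Finset.mem_range.1 ht))).symm

theorem sum_edgeCount_mul (g : ℕ → Fin k) (n : ℕ) (f : Fin k × Fin k → ℝ) :
    ∑ e, (edgeCount g n e : ℝ) * f e = ∑ t ∈ Finset.range n, f (g t, g (t + 1)) := by
  simp only [edgeCount, Int.cast_sum, Finset.sum_mul]
  rw [Finset.sum_comm]
  refine Finset.sum_congr rfl fun t _ => ?_
  rw [Finset.sum_eq_single (g t, g (t + 1))]
  · simp
  · intro e _ he
    simp [Ne.symm he]
  · simp

theorem edgeCount_nonneg (g : ℕ → Fin k) (n : ℕ) (e : Fin k × Fin k) : 0 ≤ edgeCount g n e :=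
  Finset.sum_nonneg fun t _ => by split_ifs <;> simp

theorem edgeCount_le (g : ℕ → Fin k) (n : ℕ) (e : Fin k × Fin k) : edgeCount g n e ≤ n := by
  refine (Finset.sum_le_card_nsmul (Finset.range n) _ (1 : ℤ) fun t _ => ?_).trans (by simp)
  split_ifs <;> simp

theorem exists_of_edgeCount_ne_zero {g : ℕ → Fin k} {n : ℕ} {e : Fin k × Fin k}
    (h : edgeCount g n e ≠ 0) : ∃ t, t < n ∧ (g t, g (t + 1)) = e := by
  obtain ⟨t, ht, h1⟩ := Finset.exists_ne_zero_of_sum_ne_zero h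
  exact ⟨t, Finset.mem_range.1 ht, by simpa using h1⟩

theorem edgeCount_ne_zero {g : ℕ → Fin k} {n t : ℕ} (ht : t < n) :
    edgeCount g n (g t, g (t + 1)) ≠ 0 := by
  have h := Finset.single_le_sum
    (f := fun s => if (g s, g (s + 1)) = (g t, g (t + 1)) then (1 : ℤ) else 0)
    (fun s _ => by split_ifs <;> simp) (Finset.mem_range.2 ht)
  simp only [if_true] at h
  exact fun h0 => by rw [edgeCount] at h0; omega

theorem sum_edgeCount (g : ℕ → Fin k) (n : ℕ) : ∑ e, edgeCount g n e = n := by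
  have h := sum_edgeCount_mul g n fun _ => 1
  simp only [mul_one, Finset.sum_const, Finset.card_range, nsmul_eq_mul] at h
  exact_mod_cast h

/-- Flow conservation: out-degree minus in-degree singles out the two ends of a walk. -/
theorem edgeCount_flow (g : ℕ → Fin k) (n : ℕ) (x : Fin k) :
    ∑ e : Fin k × Fin k, (edgeCount g n e : ℝ) *
        ((if e.1 = x then 1 else 0) - (if e.2 = x then 1 else 0)) =
      (if g 0 = x then 1 else 0) - (if g n = x then 1 else 0) := by
  rw [sum_edgeCount_mul]
  exact Finset.sum_range_sub' (fun t => if g t = x then (1 : ℝ) else 0) n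

/-- The edge counts of a walk and its end determine its length and its start. -/
theorem eq_of_edgeCount_eq {g g' : ℕ → Fin k} {n n' : ℕ}
    (h : ∀ e, edgeCount g n e = edgeCount g' n' e) (hend : g n = g' n') :
    n = n' ∧ g 0 = g' 0 := by
  constructor
  · have h1 := sum_edgeCount g n
    rw [Finset.sum_congr rfl fun e _ => h e, sum_edgeCount] at h1
    exact_mod_cast h1.symm
  · have h1 := edgeCount_flow g n (g 0)
    simp only [h] at h1
    rw [edgeCount_flow, hend] at h1
    by_contra h0
    rw [if_neg (Ne.symm h0), if_pos trivial] at h1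
    linarith

/-! ### Potentials -/

/-- If all short closed walks have non-positive weight, then the largest weight of a walk of
length less than `k` from a given vertex is a potential that dominates the matrix. -/
theorem exists_potential (hk : 1 ≤ k) (A : Mat k)
    (hA : ∀ n i, 1 ≤ n → n ≤ k → pow A n i i ≤ 0) :
    ∃ h : Fin k → ℝ, ∀ i j, A i j ≤ ((h i - h j : ℝ) : Rmax) := by
  let H : Fin k → Rmax := fun i =>
    (Finset.range k ×ˢ Finset.univ).sup fun q : ℕ × Fin k => pow A q.1 i q.2
  have hle : ∀ n i j, n < k → pow A n i j ≤ H i := fun n i j hn =>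
    Finset.le_sup (f := fun q : ℕ × Fin k => pow A q.1 i q.2) (b := (n, j)) (by simpa using hn)
  have hcut : ∀ i j, pow A k i j ≤ H i := by
    intro i j
    by_cases hbot : pow A k i j = ⊥
    · rw [hbot]; exact bot_le
    obtain ⟨g, rfl, hgj, hg⟩ := exists_walk A k i j hbot
    obtain ⟨u, r, x, hr, hur, hgu, hx, hxle⟩ := exists_cycle_cut A g le_rfl
    have h2 := walkWeight_window_le_pow A g u (r + 1)
    rw [← hgu] at h2
    have h4 := add_le_add hxle (h2.trans (hA (r + 1) _ (by omega) hr))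
    rw [add_zero, ← hx, hg, hgj] at h4
    exact h4.trans (hle _ _ _ (by omega))
  have hH : ∀ i, H i ≠ ⊥ := fun i => by
    refine ne_bot_of_le_ne_bot ?_ (hle 0 i i hk)
    simp [pow, one]
  refine ⟨fun i => (H i).unbot (hH i), fun i j => ?_⟩
  have hstep : A i j + H j ≤ H i := by
    obtain ⟨q, hq, hqe⟩ := Finset.exists_mem_eq_sup (Finset.range k ×ˢ Finset.univ)
      ⟨(0, j), by simp; omega⟩ (fun q : ℕ × Fin k => pow A q.1 j q.2)
    have hq' : q.1 < k := by simpa using hq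
    change H j = _ at hqe
    rw [hqe]
    refine (le_mul A (pow A q.1) i j q.2).trans ?_
    change pow A (q.1 + 1) i q.2 ≤ H i
    rcases Nat.lt_or_ge (q.1 + 1) k with h | h
    · exact hle _ _ _ h
    · have : q.1 + 1 = k := by omega
      rw [this]
      exact hcut _ _
  by_cases hbot : A i j = ⊥
  · rw [hbot]; exact bot_le
  rw [← coe_entry hbot, WithBot.coe_le_coe]
  rw [← coe_entry hbot, ← WithBot.coe_unbot (H i) (hH i), ← WithBot.coe_unbot (H j) (hH j),
    ← WithBot.coe_add, WithBot.coe_le_coe] at hstep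
  linarith

/-! ### The critical cycle of a generic matrix -/

/-- The finite entries of `A` satisfy no non-trivial linear relation with integer coefficients of
absolute value at most `K`. -/
def Generic (K : ℤ) (A : Mat k) : Prop :=
  ∀ f : Fin k × Fin k → ℤ, (∀ e, |f e| ≤ K) → (∀ e, f e ≠ 0 → A e.1 e.2 ≠ ⊥) →
    ∑ e, (f e : ℝ) * entry A e = 0 → ∀ e, f e = 0

/-- `(i, j)` is an edge of the bi-infinite walk `γ`. -/
def IsEdge (γ : ℤ → Fin k) (i j : Fin k) : Prop := ∃ t : ℤ, γ t = i ∧ γ (t + 1) = j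

theorem walkWeight_scale (μ : ℝ) (h : Fin k → ℝ) (A : Mat k) (g : ℕ → Fin k) (n : ℕ) :
    walkWeight (scale μ h A) g n =
      walkWeight A g n + ((n * μ + h (g n) - h (g 0) : ℝ) : Rmax) := by
  induction n with
  | zero => simp [walkWeight]
  | succ n ih =>
    rw [walkWeight, Finset.sum_range_succ, ← walkWeight, ih, walkWeight, walkWeight,
      Finset.sum_range_succ, scale, add_add_add_comm, ← WithBot.coe_add]
    congr 2
    push_cast
    ring

theorem walkWeight_ne_bot_of_succ {A : Mat k} {s : Fin k → Fin k} (hs : ∀ i, A i (s i) ≠ ⊥)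
    (i : Fin k) (u n : ℕ) : walkWeight A (fun t => s^[u + t] i) n ≠ ⊥ := by
  rw [walkWeight_ne_bot]
  intro t _
  rw [← Nat.add_assoc, Function.iterate_succ_apply']
  exact hs _

/-- Among the closed walks of length at most `k` there is one of maximal mean weight `lam`. -/
theorem exists_max_mean (hk : 1 ≤ k) {A : Mat k} (hA : A ∈ NoBotRow k) :
    ∃ lam : ℝ, (∀ n i, 1 ≤ n → n ≤ k → pow A n i i ≤ ((n * lam : ℝ) : Rmax)) ∧
      ∃ n i, 1 ≤ n ∧ n ≤ k ∧ pow A n i i = ((n * lam : ℝ) : Rmax) := by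
  classical
  let S : Finset (ℕ × Fin k) :=
    (Finset.Icc 1 k ×ˢ Finset.univ).filter fun q => pow A q.1 q.2 q.2 ≠ ⊥
  have hS : ∀ n i, (n, i) ∈ S ↔ (1 ≤ n ∧ n ≤ k) ∧ pow A n i i ≠ ⊥ := by simp [S]
  have hne : S.Nonempty := by
    choose s hs using hA
    obtain ⟨u, v, huv, hvk, h⟩ := exists_repeat fun t => s^[t] ⟨0, hk⟩
    obtain ⟨r, rfl⟩ := Nat.exists_eq_add_of_lt huv
    refine ⟨(r + 1, s^[u] ⟨0, hk⟩), (hS _ _).2 ⟨by omega, ?_⟩⟩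
    have h1 := walkWeight_window_le_pow A (fun t => s^[t] ⟨0, hk⟩) u (r + 1)
    rw [← Nat.add_assoc, ← h] at h1
    exact ne_bot_of_le_ne_bot (walkWeight_ne_bot_of_succ hs _ _ _) h1
  obtain ⟨⟨n, i⟩, hni, hmax⟩ := S.exists_max_image
    (fun q => (pow A q.1 q.2 q.2).unbotD 0 / q.1) hne
  have key : ∀ m j, (m, j) ∈ S →
      0 < (m : ℝ) ∧ pow A m j j = (((pow A m j j).unbotD 0 : ℝ) : Rmax) := by
    intro m j hm
    rw [hS] at hm
    obtain ⟨x, hx⟩ := WithBot.ne_bot_iff_exists.1 hm.2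
    exact ⟨by exact_mod_cast hm.1.1, by rw [← hx]; rfl⟩
  refine ⟨(pow A n i i).unbotD 0 / n, fun m j hm1 hmk => ?_, n, i, ?_⟩
  · by_cases hbot : pow A m j j = ⊥
    · rw [hbot]; exact bot_le
    have hmS := (hS m j).2 ⟨⟨hm1, hmk⟩, hbot⟩
    obtain ⟨hm0, hmx⟩ := key m j hmS
    rw [hmx, WithBot.coe_le_coe, mul_comm, ← div_le_iff₀ hm0]
    exact hmax _ hmS
  · obtain ⟨hn0, hnx⟩ := key n i hni
    have h1 := (hS n i).1 hni
    refine ⟨h1.1.1, h1.1.2, hnx.trans ?_⟩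
    rw [mul_div_cancel₀ _ hn0.ne']

theorem add_lt_coe_add_coe {x y : Rmax} {a b : ℝ} (hx : x < a) (hy : y < b) :
    x + y < (a : Rmax) + (b : Rmax) := by
  induction x using WithBot.recBotCoe with
  | bot => rw [WithBot.bot_add, ← WithBot.coe_add]; exact WithBot.bot_lt_coe _
  | coe x =>
    induction y using WithBot.recBotCoe with
    | bot => rw [WithBot.add_bot, ← WithBot.coe_add]; exact WithBot.bot_lt_coe _
    | coe y =>
      rw [WithBot.coe_lt_coe] at hx hy
      rw [← WithBot.coe_add, ← WithBot.coe_add, WithBot.coe_lt_coe]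
      exact add_lt_add hx hy

/-- A shortest closed walk of maximal mean weight visits no vertex twice. -/
theorem exists_cycle {A : Mat k} {lam : ℝ}
    (hle : ∀ n i, 1 ≤ n → n ≤ k → pow A n i i ≤ ((n * lam : ℝ) : Rmax))
    (heq : ∃ n i, 1 ≤ n ∧ n ≤ k ∧ pow A n i i = ((n * lam : ℝ) : Rmax)) :
    ∃ (l : ℕ) (γ : ℤ → Fin k), 1 ≤ l ∧ l ≤ k ∧ (∀ s t, γ s = γ t ↔ s % l = t % l) ∧
      walkWeight A (fun t : ℕ => γ t) l = ((l * lam : ℝ) : Rmax) := by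
  classical
  have hex : ∃ n, 1 ≤ n ∧ n ≤ k ∧ ∃ i, pow A n i i = ((n * lam : ℝ) : Rmax) := by
    obtain ⟨n, i, h1, h2, h3⟩ := heq
    exact ⟨n, h1, h2, i, h3⟩
  obtain ⟨hl1, hlk, i, hi⟩ := Nat.find_spec hex
  have hmin : ∀ m < Nat.find hex, 1 ≤ m → ∀ j, pow A m j j < ((m * lam : ℝ) : Rmax) := by
    intro m hm hm1 j
    refine lt_of_le_of_ne (hle m j hm1 (by omega)) fun h => ?_
    exact Nat.find_min hex hm ⟨hm1, by omega, j, h⟩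
  generalize Nat.find hex = l at *
  obtain ⟨g, rfl, hgl, hg⟩ := exists_walk A l i i (by rw [hi]; exact WithBot.coe_ne_bot)
  -- a repeated vertex splits the walk into two shorter closed walks, of smaller mean weight
  have hinj : ∀ a b, a < b → b < l → g a ≠ g b := by
    intro a b hab hbl hgab
    obtain ⟨r, rfl⟩ := Nat.exists_eq_add_of_lt hab
    obtain ⟨s, rfl⟩ := Nat.exists_eq_add_of_lt hbl
    have e : a + r + 1 + s + 1 = a + ((r + 1) + (s + 1)) := by omega
    rw [hi, e, walkWeight_add, walkWeight_add] at hg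
    have h2 := walkWeight_window_le_pow A g a (r + 1)
    rw [← Nat.add_assoc, ← hgab] at h2
    have h3 := walkWeight_window_le_pow A g (a + r + 1) (s + 1)
    rw [← Nat.add_assoc, hgl, ← hgab] at h3
    have h4 := (add_le_add (walkWeight_le_pow A g a) h3).trans (pow_add_le A a (s + 1) _ _ _)
    have h5 := hmin (r + 1) (by omega) (by omega) (g a)
    have h6 := hmin (a + (s + 1)) (by omega) (by omega) (g 0)
    have h7 : (((a + r + 1 + s + 1 : ℕ) * lam : ℝ) : Rmax) <
        (((r + 1 : ℕ) * lam : ℝ) : Rmax) + (((a + (s + 1) : ℕ) * lam : ℝ) : Rmax) := by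
      rw [e, ← hg, add_left_comm]
      refine add_lt_coe_add_coe (h2.trans_lt h5) (lt_of_le_of_lt ?_ (h4.trans_lt h6))
      exact le_of_eq (by simp only [Nat.add_assoc])
    rw [← WithBot.coe_add, WithBot.coe_lt_coe] at h7
    push_cast at h7
    linarith
  have hl0 : (0 : ℤ) < l := by exact_mod_cast hl1
  have hmod : ∀ t : ℤ, (t % l).toNat < l ∧ (((t % l).toNat : ℕ) : ℤ) = t % l := by
    intro t
    have h1 := Int.emod_nonneg t hl0.ne'
    have h2 := Int.emod_lt_of_pos t hl0
    omega
  refine ⟨l, fun t => g (t % l).toNat, hl1, hlk, fun s t => ⟨fun h => ?_, fun h => ?_⟩, ?_⟩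
  · by_contra hne
    obtain ⟨hs1, hs2⟩ := hmod s
    obtain ⟨ht1, ht2⟩ := hmod t
    rcases lt_trichotomy (s % l).toNat (t % l).toNat with h1 | h1 | h1
    · exact hinj _ _ h1 ht1 h
    · omega
    · exact hinj _ _ h1 hs1 h.symm
  · simp only [h]
  · rw [← hi, ← hg]
    refine Finset.sum_congr rfl fun t ht => ?_
    have ht' := Finset.mem_range.1 ht
    have h1 : ((t : ℤ) % l).toNat = t := by
      rw [Int.emod_eq_of_lt (by omega) (by omega)]; simp
    have h2 : g (((t + 1 : ℕ) : ℤ) % l).toNat = g (t + 1) := by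
      rcases Nat.lt_or_ge (t + 1) l with h | h
      · rw [Int.emod_eq_of_lt (by omega) (by omega)]; simp
      · have : t + 1 = l := by omega
        rw [this, Int.emod_self, hgl]; simp
    simp only [h1, h2]

/-- Uniqueness of the critical cycle: in a generic matrix the walks of maximal mean weight follow
the cycle `γ`. -/
theorem isEdge_of_critical {K : ℤ} {A : Mat k} (hgen : Generic K A) (hK : (k : ℤ) * k ≤ K)
    {lam : ℝ} {l : ℕ} {γ : ℤ → Fin k} (hl1 : 1 ≤ l) (hlk : l ≤ k)
    (hγ : walkWeight A (fun t : ℕ => γ t) l = ((l * lam : ℝ) : Rmax)) {g : ℕ → Fin k} {n : ℕ}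
    (hnk : n ≤ k) (hg : walkWeight A g n = ((n * lam : ℝ) : Rmax)) {t : ℕ} (ht : t < n) :
    IsEdge γ (g t) (g (t + 1)) := by
  have hγb : walkWeight A (fun t : ℕ => γ t) l ≠ ⊥ := by rw [hγ]; exact WithBot.coe_ne_bot
  have hgb : walkWeight A g n ≠ ⊥ := by rw [hg]; exact WithBot.coe_ne_bot
  have hγs := walkWeight_eq_coe hγb
  have hgs := walkWeight_eq_coe hgb
  rw [hγ, WithBot.coe_inj, ← sum_edgeCount_mul (fun t : ℕ => γ t) l (entry A)] at hγs
  rw [hg, WithBot.coe_inj, ← sum_edgeCount_mul g n (entry A)] at hgs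
  rw [walkWeight_ne_bot] at hγb hgb
  have hf := hgen
    (fun e => l * edgeCount g n e - n * edgeCount (fun t : ℕ => γ t) l e) ?_ ?_ ?_
    (g t, g (t + 1))
  · have h1 : edgeCount (fun t : ℕ => γ t) l (g t, g (t + 1)) ≠ 0 := by
      intro h0
      have h2 := edgeCount_ne_zero (g := g) ht
      simp only [h0, mul_zero, sub_zero, mul_eq_zero] at hf
      omega
    obtain ⟨s, -, hs⟩ := exists_of_edgeCount_ne_zero h1
    rw [Prod.mk.injEq] at hs
    exact ⟨s, hs.1, by exact_mod_cast hs.2⟩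
  · intro e
    have h1 := edgeCount_nonneg g n e
    have h2 := edgeCount_le g n e
    have h3 := edgeCount_nonneg (fun t : ℕ => γ t) l e
    have h4 := edgeCount_le (fun t : ℕ => γ t) l e
    have hlk' : (l : ℤ) ≤ k := by exact_mod_cast hlk
    have hnk' : (n : ℤ) ≤ k := by exact_mod_cast hnk
    have h5 : (l : ℤ) * edgeCount g n e ≤ k * k := by
      refine mul_le_mul hlk' (h2.trans hnk') h1 (by omega)
    have h6 : (n : ℤ) * edgeCount (fun t : ℕ => γ t) l e ≤ k * k := by
      refine mul_le_mul hnk' (h4.trans hlk') h3 (by omega)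
    have h7 : 0 ≤ (l : ℤ) * edgeCount g n e := by positivity
    have h8 : 0 ≤ (n : ℤ) * edgeCount (fun t : ℕ => γ t) l e := by positivity
    rw [abs_le]
    constructor <;> linarith
  · intro e he
    by_cases h1 : edgeCount g n e = 0
    · have h2 : edgeCount (fun t : ℕ => γ t) l e ≠ 0 := fun h2 => he (by simp [h1, h2])
      obtain ⟨s, hs, rfl⟩ := exists_of_edgeCount_ne_zero h2
      exact hγb s hs
    · obtain ⟨s, hs, rfl⟩ := exists_of_edgeCount_ne_zero h1
      exact hgb s hs
  · push_cast
    simp only [sub_mul, mul_assoc, Finset.sum_sub_distrib, ← Finset.mul_sum]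
    rw [← hγs, ← hgs]
    ring

/-! ### Strict visualization -/

/-- `A` arises from `A₀` by subtracting `lam` and conjugating with the potential `h`, in such a way
that the entries of `A` vanish along the cycle `γ` of length `l` and are negative elsewhere. The
cycle is parametrized by `ℤ`, so that it can be followed in both directions. -/
structure IsNormalForm (A₀ A : Mat k) (l : ℕ) (γ : ℤ → Fin k) (lam : ℝ) (h : Fin k → ℝ) :
    Prop where
  one_le : 1 ≤ l
  le_card : l ≤ k
  inj : ∀ s t, γ s = γ t ↔ s % l = t % l
  eq_scale : A = scale (-lam) h A₀
  edge : ∀ t, A (γ t) (γ (t + 1)) = 0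
  neg : ∀ i j, IsEdge γ i j ∨ A i j < 0

/-- The weight of a closed walk, even after a slight increase of the entries off the critical
cycle, is at most its length times the maximal mean weight. -/
theorem exists_perturbation {K : ℤ} {A : Mat k} (hgen : Generic K A) (hK : (k : ℤ) * k ≤ K)
    (hk : 1 ≤ k) {lam : ℝ} (hle : ∀ n i, 1 ≤ n → n ≤ k → pow A n i i ≤ ((n * lam : ℝ) : Rmax))
    {l : ℕ} {γ : ℤ → Fin k} (hl1 : 1 ≤ l) (hlk : l ≤ k)
    (hγ : walkWeight A (fun t : ℕ => γ t) l = ((l * lam : ℝ) : Rmax)) :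
    ∃ (ε : ℝ) (A' : Mat k), 0 < ε ∧
      (∀ n i, 1 ≤ n → n ≤ k → pow A' n i i ≤ 0) ∧
      (∀ i j, A i j + ((-lam : ℝ) : Rmax) ≤ A' i j) ∧
      (∀ i j, IsEdge γ i j ∨ A' i j = A i j + ((-lam : ℝ) : Rmax) + (ε : Rmax)) := by
  classical
  have hA₁ : ∀ (g : ℕ → Fin k) (n : ℕ),
      walkWeight (scale (-lam) 0 A) g n = walkWeight A g n + ((-(n * lam) : ℝ) : Rmax) := by
    intro g n
    rw [walkWeight_scale]
    congr 2
    simp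
  have hpos : ∀ (g : ℕ → Fin k) (n : ℕ), g n = g 0 → 1 ≤ n → n ≤ k →
      walkWeight (scale (-lam) 0 A) g n ≤ 0 := by
    intro g n hc h1 h2
    have h3 := walkWeight_le_pow A g n
    rw [hc] at h3
    rw [hA₁ g n]
    refine (add_le_add (h3.trans (hle n _ h1 h2)) le_rfl).trans ?_
    rw [← WithBot.coe_add, add_neg_cancel, WithBot.coe_zero]
  obtain ⟨δ, hδ0, hδ⟩ := exists_gap fun q : (Fin (k + 1) → Fin k) × Fin (k + 1) =>
    walkWeight (scale (-lam) 0 A) (fun t => q.1 (Fin.ofNat (k + 1) t)) q.2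
  -- only the first `k + 1` vertices matter, so finitely many walks have to be considered
  have hgap : ∀ (g : ℕ → Fin k) (n : ℕ), n ≤ k → walkWeight (scale (-lam) 0 A) g n < 0 →
      walkWeight (scale (-lam) 0 A) g n ≤ ((-δ : ℝ) : Rmax) := by
    intro g n hn
    have h1 := hδ (fun x => g x, ⟨n, by omega⟩)
    have h2 : walkWeight (scale (-lam) 0 A) (fun t => g (Fin.ofNat (k + 1) t)) n =
        walkWeight (scale (-lam) 0 A) g n := by
      refine Finset.sum_congr rfl fun t ht => ?_
      have ht' := Finset.mem_range.1 ht
      simp only [Fin.val_ofNat]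
      rw [Nat.mod_eq_of_lt (by omega), Nat.mod_eq_of_lt (by omega)]
    simp only [h2] at h1
    exact h1
  have hk0 : (0 : ℝ) < k := by exact_mod_cast hk
  have hε0 : 0 < δ / k := div_pos hδ0 hk0
  let A' : Mat k := fun i j =>
    scale (-lam) 0 A i j + ((if IsEdge γ i j then 0 else δ / k : ℝ) : Rmax)
  have hsc : ∀ i j, scale (-lam) 0 A i j = A i j + ((-lam : ℝ) : Rmax) := by
    intro i j
    simp [scale]
  refine ⟨δ / k, A', hε0, fun n i h1 h2 => ?_, fun i j => ?_, fun i j => ?_⟩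
  · by_cases hbot : pow A' n i i = ⊥
    · rw [hbot]; exact bot_le
    obtain ⟨g, hg0, hgn, hg⟩ := exists_walk A' n i i hbot
    have hc : g n = g 0 := hgn.trans hg0.symm
    rw [← hg]
    by_cases hall : ∀ t, t < n → IsEdge γ (g t) (g (t + 1))
    · refine le_trans (le_of_eq ?_) (hpos g n hc h1 h2)
      refine Finset.sum_congr rfl fun t ht => ?_
      simp only [A', if_pos (hall t (Finset.mem_range.1 ht)), WithBot.coe_zero, add_zero]
    · have hneg : walkWeight (scale (-lam) 0 A) g n < 0 := by
        refine lt_of_le_of_ne (hpos g n hc h1 h2) fun h0 => hall fun t ht => ?_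
        refine isEdge_of_critical hgen hK hl1 hlk hγ h2 ?_ ht
        rw [hA₁ g n] at h0
        have h3 : walkWeight A g n ≠ ⊥ := fun h3 => by simp [h3] at h0
        obtain ⟨x, hx⟩ := WithBot.ne_bot_iff_exists.1 h3
        rw [← hx, ← WithBot.coe_add, ← WithBot.coe_zero, WithBot.coe_inj] at h0
        rw [← hx, WithBot.coe_inj]
        linarith
      have h4 : walkWeight A' g n ≤
          walkWeight (scale (-lam) 0 A) g n + ((n * (δ / k) : ℝ) : Rmax) := by
        have h5 : ((n * (δ / k) : ℝ) : Rmax) = ∑ t ∈ Finset.range n, ((δ / k : ℝ) : Rmax) := by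
          rw [← WithBot.coe_sum]; simp
        rw [h5, walkWeight, walkWeight, ← Finset.sum_add_distrib]
        refine Finset.sum_le_sum fun t _ => add_le_add le_rfl (WithBot.coe_le_coe.2 ?_)
        split_ifs
        · exact hε0.le
        · exact le_rfl
      refine h4.trans ((add_le_add (hgap g n h2 hneg) le_rfl).trans ?_)
      rw [← WithBot.coe_add, ← WithBot.coe_zero, WithBot.coe_le_coe]
      have h6 : (n : ℝ) * (δ / k) ≤ k * (δ / k) := by
        gcongr
      rw [mul_div_cancel₀ _ hk0.ne'] at h6
      linarith
  · rw [← hsc]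
    simp only [A']
    refine le_add_of_nonneg_right ?_
    rw [← WithBot.coe_zero, WithBot.coe_le_coe]
    split_ifs
    · exact le_rfl
    · exact hε0.le
  · by_cases h : IsEdge γ i j
    · exact Or.inl h
    · right
      simp only [A', if_neg h, hsc]

/-- The potential is taken for the perturbed matrix of `exists_perturbation`. This makes the entries
off the cycle negative, and not only non-positive. -/
theorem exists_isNormalForm {K : ℤ} {A₀ : Mat k} (hA₀ : A₀ ∈ NoBotRow k) (hgen : Generic K A₀)
    (hK : (k : ℤ) * k ≤ K) (hk : 1 ≤ k) :
    ∃ (l : ℕ) (γ : ℤ → Fin k) (lam : ℝ) (h : Fin k → ℝ),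
      IsNormalForm A₀ (scale (-lam) h A₀) l γ lam h := by
  obtain ⟨lam, hle, heq⟩ := exists_max_mean hk hA₀
  obtain ⟨l, γ, hl1, hlk, hinj, hγ⟩ := exists_cycle hle heq
  obtain ⟨ε, A', hε, hA', hlow, hoff⟩ := exists_perturbation hgen hK hk hle hl1 hlk hγ
  obtain ⟨h, hh⟩ := exists_potential hk A' hA'
  have hscale : ∀ i j, scale (-lam) h A₀ i j =
      A₀ i j + ((-lam : ℝ) : Rmax) + ((h j - h i : ℝ) : Rmax) := by
    intro i j
    rw [scale, add_assoc, ← WithBot.coe_add]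
    congr 2
    ring
  have hnonpos : ∀ i j, scale (-lam) h A₀ i j ≤ 0 := by
    intro i j
    rw [hscale]
    refine (add_le_add ((hlow i j).trans (hh i j)) le_rfl).trans (le_of_eq ?_)
    rw [← WithBot.coe_add, ← WithBot.coe_zero]
    congr 1
    ring
  refine ⟨l, γ, lam, h, hl1, hlk, hinj, rfl, fun t => ?_, fun i j => ?_⟩
  · have hsum : walkWeight (scale (-lam) h A₀) (fun t : ℕ => γ t) l = 0 := by
      have h0 : γ l = γ 0 := (hinj _ _).2 (by simp)
      rw [walkWeight_scale, hγ, ← WithBot.coe_add, ← WithBot.coe_zero, WithBot.coe_inj]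
      simp only [Nat.cast_zero, h0]
      ring
    have hl0 : (0 : ℤ) < l := by exact_mod_cast hl1
    have h1 := Int.emod_nonneg t hl0.ne'
    have h2 := Int.emod_lt_of_pos t hl0
    have h3 := (Finset.sum_eq_zero_iff_of_nonpos
      fun s _ => hnonpos (γ (s : ℕ)) (γ ((s + 1 : ℕ) : ℤ))).1 hsum (t % l).toNat
      (by rw [Finset.mem_range]; omega)
    have h4 : γ (((t % l).toNat : ℕ) : ℤ) = γ t := by
      rw [hinj]; simp [Int.toNat_of_nonneg h1]
    have h5 : γ (((t % l).toNat + 1 : ℕ) : ℤ) = γ (t + 1) := by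
      rw [hinj]; push_cast; simp [Int.toNat_of_nonneg h1]
    rwa [h4, h5] at h3
  · refine (hoff i j).imp id fun h1 => ?_
    have h2 := hh i j
    rw [hscale]
    rw [h1] at h2
    induction hx : A₀ i j using WithBot.recBotCoe with
    | bot => simp
    | coe x =>
      rw [hx, ← WithBot.coe_add, ← WithBot.coe_add, WithBot.coe_le_coe] at h2
      rw [← WithBot.coe_add, ← WithBot.coe_add, ← WithBot.coe_zero, WithBot.coe_lt_coe]
      linarith

/-! ### Column maxima of high powers -/

namespace IsNormalForm

variable {A₀ A : Mat k} {l : ℕ} {γ : ℤ → Fin k} {lam : ℝ} {h : Fin k → ℝ}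

theorem nonpos (nf : IsNormalForm A₀ A l γ lam h) (i j : Fin k) : A i j ≤ 0 := by
  rcases nf.neg i j with ⟨t, rfl, rfl⟩ | h1
  · exact (nf.edge t).le
  · exact h1.le

theorem eq_of_eq (nf : IsNormalForm A₀ A l γ lam h) {s t : ℤ} (hst : γ s = γ t) (d : ℤ) :
    γ (s + d) = γ (t + d) :=
  (nf.inj _ _).2 (Int.ModEq.add_right d ((nf.inj _ _).1 hst))

theorem transpose (nf : IsNormalForm A₀ A l γ lam h) :
    IsNormalForm (tr A₀) (tr A) l (fun t => γ (-t)) lam (-h) where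
  one_le := nf.one_le
  le_card := nf.le_card
  inj s t := by
    rw [nf.inj]
    refine ⟨fun h1 => ?_, fun h1 => Int.ModEq.neg h1⟩
    have h2 := Int.ModEq.neg (show -s ≡ -t [ZMOD l] from h1)
    rwa [neg_neg, neg_neg] at h2
  eq_scale := by
    rw [nf.eq_scale]
    funext i j
    simp only [tr, scale, Pi.neg_apply]
    congr 2
    ring
  edge t := by
    have h1 := nf.edge (-(t + 1))
    rwa [neg_add, neg_add_cancel_right, ← neg_add] at h1
  neg i j := by
    refine (nf.neg j i).imp ?_ id
    rintro ⟨t, rfl, rfl⟩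
    exact ⟨-(t + 1), by simp, by simp⟩

theorem pow_cycle (nf : IsNormalForm A₀ A l γ lam h) (n : ℕ) (t : ℤ) :
    pow A n (γ (t - n)) (γ t) = 0 := by
  refine le_antisymm (pow_nonpos nf.nonpos _ _ _) ?_
  induction n with
  | zero => simp [pow, one]
  | succ n ih =>
    have h1 := le_mul A (pow A n) (γ (t - (n + 1 : ℕ))) (γ (t - n)) (γ t)
    have h2 : t - (n + 1 : ℕ) + 1 = t - n := by push_cast; ring
    rw [← h2, nf.edge, zero_add, h2] at h1
    exact ih.trans h1

theorem eq_of_edge (nf : IsNormalForm A₀ A l γ lam h) {i : Fin k} {t : ℤ} (hi : A i (γ t) = 0) :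
    i = γ (t - 1) := by
  rcases nf.neg i (γ t) with ⟨s, rfl, hs⟩ | h1
  · have := nf.eq_of_eq hs (-1)
    rwa [add_neg_cancel_right] at this
  · exact absurd hi h1.ne

theorem eq_of_walkWeight_eq_zero (nf : IsNormalForm A₀ A l γ lam h) {g : ℕ → Fin k} {m : ℕ}
    {t : ℤ} (hg : walkWeight A g m = 0) (hm : g m = γ t) : g 0 = γ (t - m) := by
  have hz : ∀ s, s < m → A (g s) (g (s + 1)) = 0 := fun s hs =>
    (Finset.sum_eq_zero_iff_of_nonpos fun s _ => nf.nonpos (g s) (g (s + 1))).1 hg s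
      (Finset.mem_range.2 hs)
  clear hg
  induction m generalizing t with
  | zero => simpa using hm
  | succ m ih =>
    have h1 := hz m (Nat.lt_succ_self m)
    rw [hm] at h1
    rw [ih (nf.eq_of_edge h1) fun s hs => hz s (by omega)]
    congr 1
    push_cast
    ring

/-- An optimal walk among all sufficiently long walks of a given length to `j` starts on the
critical cycle, follows it for `m` steps, and then reaches `j` in less than `k` steps, none of
which belongs to the cycle. -/
theorem exists_tail (nf : IsNormalForm A₀ A l γ lam h) {ε : ℝ} (hε0 : 0 < ε)
    (hε : ∀ i j, IsEdge γ i j ∨ A i j ≤ ((-ε : ℝ) : Rmax)) {a : ℕ} {i j : Fin k} {P : ℝ}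
    (hmax : ∀ i, pow A a i j ≤ P) (hlow : -(ε * a) < P) (hi : pow A a i j = P) :
    ∃ (t : ℤ) (m r : ℕ) (g : ℕ → Fin k), m + r = a ∧ r < k ∧ i = γ (t - m) ∧ g 0 = γ t ∧
      g r = j ∧ walkWeight A g r = P ∧ ∀ s, s < r → ¬ IsEdge γ (g s) (g (s + 1)) := by
  classical
  obtain ⟨g, rfl, rfl, hg⟩ := exists_walk A a i j (by rw [hi]; exact WithBot.coe_ne_bot)
  have hpaid : ∀ u n, (∀ s, s < n → ¬ IsEdge γ (g (u + s)) (g (u + (s + 1)))) →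
      walkWeight A (fun s => g (u + s)) n ≤ ((-(ε * n) : ℝ) : Rmax) := by
    intro u n hs
    have h1 : ((-(ε * n) : ℝ) : Rmax) = ∑ t ∈ Finset.range n, ((-ε : ℝ) : Rmax) := by
      rw [← WithBot.coe_sum]
      congr 1
      simp [mul_comm]
    rw [h1]
    exact Finset.sum_le_sum fun s hs' =>
      (hε _ _).resolve_left (hs s (Finset.mem_range.1 hs'))
  -- `m` is the time after the last step along the cycle
  have hex : ∃ m, m ≤ a ∧ ∀ s, m ≤ s → s < a → ¬ IsEdge γ (g s) (g (s + 1)) :=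
    ⟨a, le_rfl, fun s h1 h2 => absurd h1 (by omega)⟩
  obtain ⟨hma, hm⟩ := Nat.find_spec hex
  have hmin := fun n (hn : n < Nat.find hex) => Nat.find_min hex hn
  generalize Nat.find hex = m at *
  obtain ⟨r, rfl⟩ := Nat.exists_eq_add_of_le hma
  have hm0 : m ≠ 0 := by
    rintro rfl
    have h1 := hpaid 0 (0 + r) fun s hs => hm (0 + s) (by omega) (by omega)
    simp only [Nat.zero_add] at h1 hg hi hlow
    rw [hg, hi, WithBot.coe_le_coe] at h1
    linarith
  obtain ⟨t, ht⟩ : ∃ t, g m = γ t := by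
    have h1 := hmin (m - 1) (by omega)
    push Not at h1
    obtain ⟨s, hs1, hs2, t, ht0, ht⟩ := h1 (by omega)
    have : s + 1 = m := by
      by_contra h2
      exact hm s (by omega) hs2 ⟨t, ht0, ht⟩
    exact ⟨t + 1, by rw [ht, this]⟩
  rw [hi, walkWeight_add] at hg
  -- the part after time `m`, preceded by a walk along the cycle, is a competitor
  have hcomp : ∀ n, n ≤ m + r → pow A n (g m) (g (m + r)) ≤ P := by
    intro n hn
    refine le_trans ?_ (hmax (γ (t - (m + r - n : ℕ))))
    have h1 := pow_add_le A (m + r - n) n (γ (t - (m + r - n : ℕ))) (γ t) (g (m + r))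
    rwa [nf.pow_cycle, zero_add, ← ht, Nat.sub_add_cancel hn] at h1
  have htail : walkWeight A (fun s => g (m + s)) r ≤ P :=
    (walkWeight_window_le_pow A g m r).trans (hcomp r (by omega))
  have hhead : walkWeight A g m ≤ 0 :=
    Finset.sum_nonpos fun s _ => nf.nonpos (g s) (g (s + 1))
  obtain ⟨x, hx⟩ := WithBot.ne_bot_iff_exists.1
    (show walkWeight A g m ≠ ⊥ from fun h0 => by simp [h0] at hg)
  obtain ⟨y, hy⟩ := WithBot.ne_bot_iff_exists.1
    (show walkWeight A (fun s => g (m + s)) r ≠ ⊥ from fun h0 => by simp [h0] at hg)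
  rw [← hx, ← WithBot.coe_zero, WithBot.coe_le_coe] at hhead
  rw [← hy, WithBot.coe_le_coe] at htail
  rw [← hx, ← hy, ← WithBot.coe_add, WithBot.coe_inj] at hg
  refine ⟨t, m, r, fun s => g (m + s), rfl, ?_, ?_, ht, rfl, ?_, fun s hs =>
    hm (m + s) (by omega) (by omega)⟩
  -- a tail with a repeated vertex contains a closed walk of negative weight
  · by_contra hr
    push Not at hr
    obtain ⟨u, v, z, -, huv, -, hz, hzle⟩ := exists_cycle_cut A (fun s => g (m + s)) hr
    have h1 := hpaid (m + u) (v + 1) fun s hs =>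
      hm (m + u + s) (by omega) (by omega)
    have h2 := hzle.trans (hcomp (r - (v + 1)) (by omega))
    have h3 := add_le_add h2 h1
    simp only [Nat.add_assoc] at h3 hz
    rw [← hz, ← hy, ← WithBot.coe_add, WithBot.coe_le_coe] at h3
    have h4 : 0 < ε * (v + 1 : ℕ) := by positivity
    linarith
  · refine nf.eq_of_walkWeight_eq_zero ?_ ht
    rw [← hx, ← WithBot.coe_zero, WithBot.coe_inj]
    linarith
  · rw [← hy, WithBot.coe_inj]
    linarith

/-- In normal form, `l` times the weight of a walk is an integer combination of the original
entries, up to the difference of the potentials at its ends. -/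
theorem mul_weight_eq (nf : IsNormalForm A₀ A l γ lam h) {g : ℕ → Fin k} {n : ℕ} {x : ℝ}
    (hx : walkWeight A g n = x) :
    l * x = ∑ e, ((l * edgeCount g n e - n * edgeCount (fun t : ℕ => γ t) l e : ℤ) : ℝ) *
      entry A₀ e + l * (h (g n) - h (g 0)) := by
  have key : ∀ (g : ℕ → Fin k) (n : ℕ) (x : ℝ), walkWeight A g n = x →
      x = ∑ e, (edgeCount g n e : ℝ) * entry A₀ e - n * lam + (h (g n) - h (g 0)) := by
    intro g n x hx
    rw [nf.eq_scale, walkWeight_scale] at hx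
    have h1 : walkWeight A₀ g n ≠ ⊥ := fun h1 => by simp [h1] at hx
    rw [walkWeight_eq_coe h1, ← WithBot.coe_add, WithBot.coe_inj] at hx
    rw [sum_edgeCount_mul, ← hx]
    ring
  have h1 := key g n x hx
  have h2 := key (fun t : ℕ => γ t) l 0 (by
    rw [walkWeight, WithBot.coe_zero]
    exact Finset.sum_eq_zero fun t _ => by push_cast; exact nf.edge t)
  have h0 : γ l = γ 0 := (nf.inj _ _).2 (by simp)
  simp only [Nat.cast_zero, h0] at h2
  rw [h1]
  push_cast
  simp only [sub_mul, mul_assoc, Finset.sum_sub_distrib, ← Finset.mul_sum]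
  linear_combination -(n : ℝ) * h2

end IsNormalForm

/-- The coefficients of the linear form that gives `l` times the weight of the walk from `γ 0`
that follows `γ` for `d` steps and then the first `r` steps of `g`. -/
def walkForm (l : ℕ) (γ : ℤ → Fin k) (d : ℕ) (g : ℕ → Fin k) (r : ℕ) (e : Fin k × Fin k) : ℤ :=
  (l * edgeCount (fun t : ℕ => γ t) d e - d * edgeCount (fun t : ℕ => γ t) l e) +
    (l * edgeCount g r e - r * edgeCount (fun t : ℕ => γ t) l e)

theorem abs_walkForm_le {l d r : ℕ} (hl : l ≤ k) (hd : d ≤ k) (hr : r ≤ k) (γ : ℤ → Fin k)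
    (g : ℕ → Fin k) (e : Fin k × Fin k) : |walkForm l γ d g r e| ≤ 2 * k ^ 2 := by
  have key : ∀ (p q : ℕ) (g : ℕ → Fin k), p ≤ k → q ≤ k →
      0 ≤ (p : ℤ) * edgeCount g q e ∧ (p : ℤ) * edgeCount g q e ≤ k ^ 2 := by
    intro p q g hp hq
    have h1 := edgeCount_nonneg g q e
    have h2 := edgeCount_le g q e
    have hp' : (p : ℤ) ≤ k := by exact_mod_cast hp
    have hq' : (q : ℤ) ≤ k := by exact_mod_cast hq
    refine ⟨by positivity, ?_⟩
    rw [sq]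
    exact mul_le_mul hp' (h2.trans hq') h1 (by omega)
  have h1 := key l d (fun t : ℕ => γ t) hl hd
  have h2 := key d l (fun t : ℕ => γ t) hd hl
  have h3 := key l r g hl hr
  have h4 := key r l (fun t : ℕ => γ t) hr hl
  rw [walkForm, abs_le]
  constructor <;> linarith

theorem edgeCount_cycle_eq_zero {γ : ℤ → Fin k} {e : Fin k × Fin k} (he : ¬ IsEdge γ e.1 e.2)
    (n : ℕ) : edgeCount (fun t : ℕ => γ t) n e = 0 := by
  by_contra h0
  obtain ⟨s, -, rfl⟩ := exists_of_edgeCount_ne_zero h0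
  exact he ⟨s, rfl, by simp⟩

/-- The linear form of a walk that leaves the cycle at once, and its end, determine its length and
its start. -/
theorem eq_of_walkForm_eq {l d d' r r' : ℕ} (hl : 1 ≤ l) {γ : ℤ → Fin k} {g g' : ℕ → Fin k}
    (hg : ∀ s, s < r → ¬ IsEdge γ (g s) (g (s + 1)))
    (hg' : ∀ s, s < r' → ¬ IsEdge γ (g' s) (g' (s + 1))) (hend : g r = g' r')
    (hform : ∀ e, walkForm l γ d g r e = walkForm l γ d' g' r' e) :
    r = r' ∧ g 0 = g' 0 := by
  refine eq_of_edgeCount_eq (fun e => ?_) hend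
  by_cases he : IsEdge γ e.1 e.2
  · have hz : ∀ (g : ℕ → Fin k) (r : ℕ), (∀ s, s < r → ¬ IsEdge γ (g s) (g (s + 1))) →
        edgeCount g r e = 0 := by
      intro g r hg
      by_contra h0
      obtain ⟨s, hs, rfl⟩ := exists_of_edgeCount_ne_zero h0
      exact hg s hs he
    rw [hz g r hg, hz g' r' hg']
  · have h1 := hform e
    simp only [walkForm, edgeCount_cycle_eq_zero he, mul_zero, sub_zero, zero_add] at h1
    exact mul_left_cancel₀ (by exact_mod_cast (by omega : l ≠ 0)) h1

theorem IsNormalForm.exists_walkForm {A₀ A : Mat k} {l : ℕ} {γ : ℤ → Fin k} {lam : ℝ}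
    {h : Fin k → ℝ} (nf : IsNormalForm A₀ A l γ lam h) {t : ℤ} {r : ℕ} {g : ℕ → Fin k}
    {P : ℝ} (hr : r < k) (hg0 : g 0 = γ t) (hg : walkWeight A g r = P) :
    ∃ d, (∀ e, |walkForm l γ d g r e| ≤ 2 * k ^ 2) ∧
      (∀ e, walkForm l γ d g r e ≠ 0 → A₀ e.1 e.2 ≠ ⊥) ∧
      l * P = ∑ e, (walkForm l γ d g r e : ℝ) * entry A₀ e + l * (h (g r) - h (γ 0)) := by
  have hl0 : (0 : ℤ) < l := by exact_mod_cast nf.one_le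
  have h1 := Int.emod_nonneg t hl0.ne'
  have h2 := Int.emod_lt_of_pos t hl0
  have hlk := nf.le_card
  have hbot : ∀ {i j : Fin k}, A i j ≠ ⊥ → A₀ i j ≠ ⊥ := fun {i j} hij h0 =>
    hij (by rw [nf.eq_scale, scale_eq_bot, h0])
  have hcyc : ∀ (n : ℕ) (e : Fin k × Fin k), edgeCount (fun t : ℕ => γ t) n e ≠ 0 →
      A₀ e.1 e.2 ≠ ⊥ := by
    intro n e he
    obtain ⟨s, -, rfl⟩ := exists_of_edgeCount_ne_zero he
    refine hbot ?_
    push_cast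
    rw [nf.edge]
    exact WithBot.coe_ne_bot
  -- the approach along `γ` from `γ 0` to `γ t` makes all walks start at the same vertex, so that
  -- the potential at the start cancels when two walks are compared
  refine ⟨(t % l).toNat, abs_walkForm_le hlk (by omega) hr.le γ g, fun e he => ?_, ?_⟩
  · by_cases e1 : edgeCount (fun t : ℕ => γ t) (t % l).toNat e = 0
    · by_cases e2 : edgeCount (fun t : ℕ => γ t) l e = 0
      · by_cases e3 : edgeCount g r e = 0
        · simp [walkForm, e1, e2, e3] at he
        · obtain ⟨s, hs, rfl⟩ := exists_of_edgeCount_ne_zero e3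
          have h3 : walkWeight A g r ≠ ⊥ := by rw [hg]; exact WithBot.coe_ne_bot
          exact hbot (walkWeight_ne_bot.1 h3 s hs)
      · exact hcyc _ _ e2
    · exact hcyc _ _ e1
  · have h3 := nf.mul_weight_eq hg
    have h4 := nf.mul_weight_eq (g := fun s : ℕ => γ s) (n := (t % l).toNat) (x := 0) (by
      rw [walkWeight, WithBot.coe_zero]
      exact Finset.sum_eq_zero fun t _ => by push_cast; exact nf.edge t)
    have h5 : γ (((t % l).toNat : ℕ) : ℤ) = γ t := by
      rw [nf.inj]; simp [Int.toNat_of_nonneg h1]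
    simp only [h5, Nat.cast_zero, mul_zero] at h4
    rw [hg0] at h3
    simp only [walkForm, Int.cast_add, add_mul, Finset.sum_add_distrib]
    rw [h3]
    linear_combination h4

/-- In each column of some power of a generic matrix the maximum is attained at a single row,
which lies on the critical cycle; its value is a linear form in the original entries, up to
potentials. -/
theorem IsNormalForm.exists_column_max {A₀ A : Mat k} {l : ℕ} {γ : ℤ → Fin k} {lam : ℝ}
    {h : Fin k → ℝ} (nf : IsNormalForm A₀ A l γ lam h) (hA : A ∈ NoBotRow k) {n : ℕ}
    (hn1 : 1 ≤ n) (hn : IsFin (pow A n)) (hgen : Generic (8 * k ^ 2) A₀) :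
    ∃ a, 1 ≤ a ∧ IsFin (pow A a) ∧ ∀ j, ∃ (P : ℝ) (s : ℤ) (f : Fin k × Fin k → ℤ),
      (∀ i, pow A a i j ≤ P) ∧ (∃ i, pow A a i j = P) ∧ (∀ i, pow A a i j = P → i = γ s) ∧
      (∀ e, |f e| ≤ 2 * k ^ 2) ∧ (∀ e, f e ≠ 0 → A₀ e.1 e.2 ≠ ⊥) ∧
      l * P = ∑ e, (f e : ℝ) * entry A₀ e + l * (h j - h (γ 0)) := by
  obtain ⟨ε, hε0, hε⟩ := exists_gap (fun q : Fin k × Fin k => A q.1 q.2)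
  replace hε : ∀ i j, IsEdge γ i j ∨ A i j ≤ ((-ε : ℝ) : Rmax) := fun i j =>
    (nf.neg i j).imp id fun h => hε (i, j) h
  obtain ⟨T, hT0, hT⟩ := exists_lower_bound (fun q : Fin k × Fin k => pow A n q.1 q.2)
    fun q => hn q.1 q.2
  obtain ⟨b, hb⟩ := exists_nat_gt (T / ε)
  have hfin : IsFin (pow A (b + n)) := isFin_pow_of_le hA hn (by omega)
  refine ⟨b + n, by omega, hfin, fun j => ?_⟩
  have : Nonempty (Fin k) := ⟨j⟩
  obtain ⟨i, hi⟩ := Finite.exists_max fun i => pow A (b + n) i j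
  obtain ⟨P, hP⟩ := WithBot.ne_bot_iff_exists.1 (hfin i j)
  rw [← hP] at hi
  have hlow : -(ε * (b + n : ℕ)) < P := by
    have h1 := pow_add_le A b n (γ (0 - b)) (γ 0) j
    rw [nf.pow_cycle, zero_add] at h1
    have h2 := ((hT (γ 0, j)).trans h1).trans (hi _)
    rw [WithBot.coe_le_coe] at h2
    rw [div_lt_iff₀ hε0] at hb
    have h3 : ε * b ≤ ε * (b + n : ℕ) := by
      refine mul_le_mul_of_nonneg_left ?_ hε0.le
      push_cast
      linarith [(Nat.cast_nonneg n : (0 : ℝ) ≤ n)]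
    linarith
  obtain ⟨t, m, r, g, hmr, hr, hit, hg0, rfl, hg, hoff⟩ := nf.exists_tail hε0 hε hi hlow hP.symm
  obtain ⟨d, hd1, hd2, hd3⟩ := nf.exists_walkForm hr hg0 hg
  refine ⟨P, t - m, walkForm l γ d g r, hi, ⟨i, hP.symm⟩, fun i' hi' => ?_, hd1, hd2, hd3⟩
  obtain ⟨t', m', r', g', hmr', hr', hit', hg0', hend, hg', hoff'⟩ :=
    nf.exists_tail hε0 hε hi hlow hi'
  obtain ⟨d', hd1', hd2', hd3'⟩ := nf.exists_walkForm hr' hg0' hg'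
  rw [hend] at hd3'
  -- both walks have weight `P`, so the difference of their forms is a small integer relation
  have hform := hgen (fun e => walkForm l γ d g r e - walkForm l γ d' g' r' e)
    (fun e => by
      have h1 := abs_le.1 (hd1 e)
      have h2 := abs_le.1 (hd1' e)
      have h3 : (0 : ℤ) ≤ (k : ℤ) ^ 2 := by positivity
      rw [abs_le]
      constructor <;> linarith)
    (fun e he => by
      by_cases h1 : walkForm l γ d g r e = 0
      · exact hd2' e fun h2 => he (by simp [h1, h2])
      · exact hd2 e h1)
    (by
      push_cast
      simp only [sub_mul, Finset.sum_sub_distrib]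
      linarith)
  obtain ⟨rfl, h0⟩ := eq_of_walkForm_eq nf.one_le hoff hoff' hend.symm
    fun e => sub_eq_zero.1 (hform e)
  have hm : m' = m := by omega
  rw [hit', hm]
  refine nf.eq_of_eq (d := -(m : ℤ)) ?_
  rw [← hg0, ← hg0', h0]

/-! ### Words of rank one in generic pairs -/

/-- The finite entries of `A` and `B` satisfy no non-trivial linear relation with integer
coefficients of absolute value at most `K`. -/
def GenericPair (K : ℤ) (A B : Mat k) : Prop :=
  ∀ f : (Fin k × Fin k) ⊕ (Fin k × Fin k) → ℤ, (∀ q, |f q| ≤ K) →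
    (∀ q, f q ≠ 0 → pairEntries (A, B) q ≠ ⊥) →
    ∑ q, (f q : ℝ) * (pairEntries (A, B) q).unbotD 0 = 0 → ∀ q, f q = 0

theorem GenericPair.left {K : ℤ} {A B : Mat k} (h : GenericPair K A B) : Generic K A := by
  intro f hf hbot hsum e
  refine h (Sum.elim f 0) ?_ ?_ ?_ (Sum.inl e)
  · rintro (e | e)
    · exact hf e
    · simpa using (abs_nonneg (f e)).trans (hf e)
  · rintro (e | e) he
    · exact hbot e he
    · simp at he
  · simpa [Fintype.sum_sum_type, pairEntries, entry] using hsum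

theorem sum_entry_tr (A : Mat k) (f : Fin k × Fin k → ℝ) :
    ∑ e, f e * entry (tr A) e = ∑ e : Fin k × Fin k, f e.swap * entry A e :=
  Fintype.sum_equiv (Equiv.prodComm _ _) _ _ fun _ => rfl

theorem Generic.transpose {K : ℤ} {A : Mat k} (h : Generic K A) : Generic K (tr A) := by
  intro f hf hbot hsum e
  rw [sum_entry_tr] at hsum
  exact h (fun e => f e.swap) (fun e => hf _) (fun e he => hbot _ he) hsum e.swap

/-- The largest entry of the finite matrix `D` is attained at a single place `(γ s, γ t)`. -/
def HasUniqueMax (D : Mat k) (γ : ℤ → Fin k) (s t : ℤ) (β : ℝ) : Prop :=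
  IsFin D ∧ D (γ s) (γ t) = β ∧ ∀ i j, D i j ≤ β ∧ (D i j = β → i = γ s ∧ j = γ t)

/-- Multiplication by `A` on the left moves the largest entry one step back along the critical
cycle. -/
theorem HasUniqueMax.mul_left {A₀ A D : Mat k} {l : ℕ} {γ : ℤ → Fin k} {lam : ℝ} {h : Fin k → ℝ}
    (nf : IsNormalForm A₀ A l γ lam h) (hA : A ∈ NoBotRow k) {s t : ℤ} {β : ℝ}
    (hD : HasUniqueMax D γ s t β) : HasUniqueMax (mul A D) γ (s - 1) t β := by
  obtain ⟨hfin, hβ, hmax⟩ := hD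
  have hle : ∀ i j, mul A D i j ≤ β := by
    intro i j
    rw [mul_le_iff]
    intro r
    simpa using add_le_add (nf.nonpos i r) (hmax r j).1
  refine ⟨isFin_mul hA hfin, le_antisymm (hle _ _) ?_, fun i j => ⟨hle i j, fun hij => ?_⟩⟩
  · have h1 := le_mul A D (γ (s - 1)) (γ s) (γ t)
    have h2 := nf.edge (s - 1)
    rw [sub_add_cancel] at h2
    rwa [h2, zero_add, hβ] at h1
  · obtain ⟨r, hr⟩ := exists_mul_eq A D i j
    rw [hij] at hr
    have h1 : D r j = β := by
      refine le_antisymm (hmax r j).1 ?_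
      rw [hr]
      simpa using add_le_add (nf.nonpos i r) (le_refl (D r j))
    obtain ⟨rfl, rfl⟩ := (hmax r j).2 h1
    refine ⟨nf.eq_of_edge ?_, rfl⟩
    rw [h1] at hr
    have h2 : A i (γ s) ≠ ⊥ := fun h2 => by simp [h2] at hr
    obtain ⟨x, hx⟩ := WithBot.ne_bot_iff_exists.1 h2
    rw [← hx, ← WithBot.coe_add, WithBot.coe_inj] at hr
    rw [← hx, ← WithBot.coe_zero, WithBot.coe_inj]
    linarith

/-- A power of `A` on either side of `B` confines the largest entry to the critical cycle, and
genericity makes it unique. -/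
theorem IsNormalForm.exists_uniqueMax {A₀ A B₀ : Mat k} {l : ℕ} {γ : ℤ → Fin k} {lam : ℝ}
    {h : Fin k → ℝ} (nf : IsNormalForm A₀ A l γ lam h) (hA : A ∈ NoBotRow k)
    (hB₀ : B₀ ∈ NoBotRow k) {n : ℕ} (hn1 : 1 ≤ n) (hn : IsFin (pow A n))
    (htr : tr A ∈ NoBotRow k) (hgen : GenericPair (8 * k ^ 2) A₀ B₀) :
    ∃ a b s t β, 1 ≤ a ∧ 1 ≤ b ∧
      HasUniqueMax (mul (pow A a) (mul (scale 0 h B₀) (pow A b))) γ s t β := by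
  obtain ⟨a, ha1, hafin, ha⟩ := nf.exists_column_max hA hn1 hn hgen.left
  have hn' : IsFin (pow (tr A) n) := by
    rw [pow_tr]
    exact fun i j => hn j i
  obtain ⟨b, hb1, hbfin, hb⟩ := nf.transpose.exists_column_max htr hn1 hn' hgen.left.transpose
  rw [pow_tr] at hbfin hb
  choose P s f hP hPex hPu hf hfbot hPf using ha
  choose Q t f' hQ hQex hQu hf' hfbot' hQf using hb
  simp only [tr, sum_entry_tr _ (fun e => (f' _ e : ℝ)), neg_zero, Pi.neg_apply] at *
  let B := scale 0 h B₀
  let D := mul (pow A a) (mul B (pow A b))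
  have hDfin : IsFin D := isFin_mul hafin.noBotRow
    (isFin_mul (noBotRow_scale hB₀) fun i j => hbfin j i)
  have hentry : ∀ i j, B i j ≠ ⊥ →
      B i j = ((entry B₀ (i, j) + (h j - h i) : ℝ) : Rmax) := by
    intro i j hij
    rw [ne_eq, scale_eq_bot] at hij
    simp only [B, scale, zero_add]
    rw [← coe_entry hij, ← WithBot.coe_add]
  have hD : ∀ i j, ∃ x y, B x y ≠ ⊥ ∧ D i j = pow A a i x + (B x y + pow A b y j) := by
    intro i j
    obtain ⟨x, hx⟩ := exists_mul_eq (pow A a) (mul B (pow A b)) i j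
    obtain ⟨y, hy⟩ := exists_mul_eq B (pow A b) x j
    refine ⟨x, y, fun hbot => hDfin i j ?_, ?_⟩
    · change mul _ _ _ _ = _
      rw [hx, hy, hbot, WithBot.bot_add, WithBot.add_bot]
    · change mul _ _ _ _ = _
      rw [hx, hy]
  have hDle : ∀ i x y j, pow A a i x + (B x y + pow A b y j) ≤ D i j := fun i x y j =>
    (add_le_add le_rfl (le_mul B (pow A b) x y j)).trans (le_mul (pow A a) _ i x j)
  obtain ⟨i₀, hi₀⟩ : ∃ i₀ : Fin k × Fin k, ∀ i : Fin k × Fin k, D i.1 i.2 ≤ D i₀.1 i₀.2 := by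
    have : Nonempty (Fin k × Fin k) := ⟨(γ 0, γ 0)⟩
    exact Finite.exists_max _
  obtain ⟨β, hβ⟩ := WithBot.ne_bot_iff_exists.1 (hDfin i₀.1 i₀.2)
  rw [← hβ] at hi₀
  -- every optimal path crosses `B` at a place `(x, y)` with `P x + B x y + Q y = β`
  have hopt : ∀ i j, D i j = β → ∃ x y, B₀ x y ≠ ⊥ ∧ i = γ (s x) ∧ j = γ (-t y) ∧
      β = P x + (entry B₀ (x, y) + (h y - h x)) + Q y := by
    intro i j hij
    obtain ⟨x, y, hxy, hDxy⟩ := hD i j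
    obtain ⟨i', hi'⟩ := hPex x
    obtain ⟨j', hj'⟩ := hQex y
    have h1 := (hDle i' x y j').trans (hi₀ (i', j'))
    obtain ⟨p, hp⟩ := WithBot.ne_bot_iff_exists.1 (hafin i x)
    obtain ⟨q, hq⟩ := WithBot.ne_bot_iff_exists.1 (hbfin j y)
    have h2 := hP x i
    have h3 := hQ y j
    change ((q : ℝ) : Rmax) = pow A b y j at hq
    rw [← hp, WithBot.coe_le_coe] at h2
    rw [← hq, WithBot.coe_le_coe] at h3
    rw [hij, ← hp, ← hq, hentry x y hxy, ← WithBot.coe_add, ← WithBot.coe_add,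
      WithBot.coe_inj] at hDxy
    rw [hi', hj', hentry x y hxy, ← WithBot.coe_add, ← WithBot.coe_add, WithBot.coe_le_coe] at h1
    have h4 : p = P x := by linarith
    have h5 : q = Q y := by linarith
    rw [ne_eq, scale_eq_bot] at hxy
    exact ⟨x, y, hxy, hPu x i (by rw [← hp, h4]), hQu y j (by rw [← hq, h5]), by linarith⟩
  -- the form that gives `l * β` along an optimal path through `(x, y)`; all potentials cancel
  let F : Fin k → Fin k → (Fin k × Fin k) ⊕ (Fin k × Fin k) → ℤ := fun x y =>
    Sum.elim (fun e => f x e + f' y e.swap) fun e => if e = (x, y) then (l : ℤ) else 0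
  have hl1 := nf.one_le
  have hlk := nf.le_card
  have hlk2 : (l : ℤ) ≤ 4 * k ^ 2 := by
    have h1 : (1 : ℤ) ≤ k := by exact_mod_cast hl1.trans hlk
    have h2 : (l : ℤ) ≤ k := by exact_mod_cast hlk
    nlinarith
  have hF : ∀ x y q, |F x y q| ≤ 4 * k ^ 2 := by
    rintro x y (e | e)
    · refine (abs_add_le _ _).trans ?_
      linarith [hf x e, hf' y e.swap]
    · simp only [F, Sum.elim_inr]
      split_ifs
      · simpa using hlk2
      · simp only [abs_zero]; positivity
  have hFbot : ∀ x y, B₀ x y ≠ ⊥ → ∀ q, F x y q ≠ 0 → pairEntries (A₀, B₀) q ≠ ⊥ := by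
    rintro x y hxy (e | e) he
    · by_cases h1 : f x e = 0
      · exact hfbot' y e.swap fun h2 => he (by simp [F, h1, h2])
      · exact hfbot x e h1
    · have h1 : e = (x, y) := by
        by_contra h1
        exact he (by simp [F, h1])
      subst h1
      exact hxy
  have hFsum : ∀ x y, β = P x + (entry B₀ (x, y) + (h y - h x)) + Q y →
      ∑ q, (F x y q : ℝ) * (pairEntries (A₀, B₀) q).unbotD 0 = l * β := by
    intro x y hxy
    have h1 : ∑ e, (((if e = (x, y) then (l : ℤ) else 0 : ℤ) : ℝ)) * entry B₀ e =
        l * entry B₀ (x, y) := by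
      rw [Finset.sum_eq_single (x, y)]
      · simp
      · intro e _ he
        simp [he]
      · simp
    have h2 : ∑ q, (F x y q : ℝ) * (pairEntries (A₀, B₀) q).unbotD 0 =
        ∑ e, ((f x e + f' y e.swap : ℤ) : ℝ) * entry A₀ e +
          ∑ e, (((if e = (x, y) then (l : ℤ) else 0 : ℤ) : ℝ)) * entry B₀ e := by
      rw [Fintype.sum_sum_type]
      rfl
    rw [h2, h1]
    simp only [Int.cast_add, add_mul, Finset.sum_add_distrib]
    have h3 := hPf x
    have h4 := hQf y
    rw [hxy]
    linear_combination -h3 - h4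
  obtain ⟨x₀, y₀, hb₀, h1, h2, h3⟩ := hopt _ _ hβ.symm
  refine ⟨a, b, s x₀, -t y₀, β, ha1, hb1, hDfin, ?_, fun i j => ⟨hi₀ (i, j), fun hij => ?_⟩⟩
  · rw [← h1, ← h2]
    exact hβ.symm
  · obtain ⟨x, y, hbxy, h1', h2', h3'⟩ := hopt i j hij
    have hzero := hgen (fun q => F x y q - F x₀ y₀ q)
      (fun q => by
        have e1 := abs_le.1 (hF x y q)
        have e2 := abs_le.1 (hF x₀ y₀ q)
        rw [abs_le]
        constructor <;> linarith)
      (fun q hq => by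
        by_cases e1 : F x y q = 0
        · exact hFbot x₀ y₀ hb₀ q fun e2 => hq (by simp [e1, e2])
        · exact hFbot x y hbxy q e1)
      (by
        push_cast
        simp only [sub_mul, Finset.sum_sub_distrib]
        rw [hFsum x y h3', hFsum x₀ y₀ h3, sub_self])
      (Sum.inr (x, y))
    have hxy : (x, y) = (x₀, y₀) := by
      by_contra hne
      simp only [F, Sum.elim_inr, if_true, if_neg hne] at hzero
      omega
    rw [Prod.mk.injEq] at hxy
    obtain ⟨rfl, rfl⟩ := hxy
    exact ⟨h1', h2'⟩

/-- A generic pair with primitive first member has a word of rank one. -/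
theorem exists_word_isRankOne (hk : 1 ≤ k) {A B : Mat k} (hA : A ∈ Primitive k)
    (hB : B ∈ NoBotRow k) (hgen : GenericPair (8 * k ^ 2) A B) :
    ∃ (N : ℕ) (w : ℕ → Mat k), 1 ≤ N ∧ (∀ i, w i = A ∨ w i = B) ∧ IsRankOne (backProd w N) := by
  obtain ⟨hrow, n, hn1, hn⟩ := hA
  obtain ⟨l, γ, lam, h, nf⟩ := exists_isNormalForm hrow hgen.left
    (by nlinarith [sq_nonneg (k : ℤ)]) hk
  have hrow' : scale (-lam) h A ∈ NoBotRow k := noBotRow_scale hrow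
  have hn' : IsFin (pow (scale (-lam) h A) n) := by
    rw [pow_scale, isFin_scale]
    exact hn
  -- a positive power with finite entries forbids columns of `-∞`
  have htr : tr (scale (-lam) h A) ∈ NoBotRow k := by
    intro j
    obtain ⟨m, rfl⟩ := Nat.exists_eq_add_of_le' hn1
    have h1 := hn' j j
    rw [maxPow_add, maxPow_one] at h1
    obtain ⟨i, hi⟩ := exists_mul_eq (pow (scale (-lam) h A) m) (scale (-lam) h A) j j
    rw [hi] at h1
    exact ⟨i, fun h0 => h1 (by rw [show scale (-lam) h A i j = ⊥ from h0, WithBot.add_bot])⟩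
  obtain ⟨a, b, s, t, β, ha, hb, hD⟩ := nf.exists_uniqueMax hrow' hB hn1 hn' htr hgen
  have hword := ((isWord_left A B h (-lam)).pow ha).mul
    ((isWord_right A B h 0).mul ((isWord_left A B h (-lam)).pow hb))
  have hrot : ∀ r : ℕ, ∃ D, IsWord A B h D ∧ HasUniqueMax D γ (s - r) t β := by
    intro r
    induction r with
    | zero => exact ⟨_, hword, by simpa using hD⟩
    | succ r ih =>
      obtain ⟨D, hw, hD⟩ := ih
      refine ⟨_, (isWord_left A B h (-lam)).mul hw, ?_⟩
      have := hD.mul_left nf hrow'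
      rwa [sub_sub, ← Nat.cast_succ] at this
  obtain ⟨D, hw, hfin, hmax, huniq⟩ := hrot ((s - t) % l).toNat
  have hl0 : (0 : ℤ) < l := by exact_mod_cast nf.one_le
  have hst : γ (s - ((s - t) % l).toNat) = γ t := by
    rw [nf.inj, Int.toNat_of_nonneg (Int.emod_nonneg _ hl0.ne')]
    have h1 : s - t - (s - t) % l ≡ 0 [ZMOD l] := by
      rw [Int.modEq_zero_iff_dvd]
      exact Int.dvd_self_sub_emod
    have h2 := Int.ModEq.add_right t h1
    rw [zero_add] at h2
    have h3 : s - t - (s - t) % l + t = s - (s - t) % l := by ring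
    rwa [h3] at h2
  rw [hst] at hmax huniq
  have hsc : ∀ i j, scale (-β) 0 D i j = D i j + ((-β : ℝ) : Rmax) := fun i j => by
    simp [scale]
  obtain ⟨R, hR, hrank⟩ := exists_pow_isRankOne (E := scale (-β) 0 D) (c := γ t)
    (isFin_scale.2 hfin)
    (by rw [hsc, hmax, ← WithBot.coe_add, add_neg_cancel, WithBot.coe_zero])
    (fun i j => by
      obtain ⟨x, hx⟩ := WithBot.ne_bot_iff_exists.1 (hfin i j)
      obtain ⟨h1, h2⟩ := huniq i j
      rw [← hx, WithBot.coe_le_coe] at h1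
      rw [← hx, WithBot.coe_inj] at h2
      rcases h1.lt_or_eq with h3 | h3
      · right
        rw [hsc, ← hx, ← WithBot.coe_add, ← WithBot.coe_zero, WithBot.coe_lt_coe]
        linarith
      · exact Or.inl (h2 h3))
  rw [pow_scale] at hrank
  obtain ⟨N, w, μ, hN, hw', hword'⟩ := hw.pow hR
  refine ⟨N, w, hN, hw', isRankOne_of_scale (μ := μ) (h := h) ?_⟩
  rw [← hword']
  exact isRankOne_of_scale hrank

/-! ### The exceptional hyperplanes and random products -/

/-- The hyperplanes of pairs of matrices given by the non-zero linear forms with integer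
coefficients of absolute value at most `K`. -/
def smallHyperplanes (k : ℕ) (K : ℤ) : Set (Set (Mat k × Mat k)) :=
  (fun f : (Fin k × Fin k) ⊕ (Fin k × Fin k) → ℤ =>
    (pairEntries ⁻¹' {V | linForm (fun q => (f q : ℝ)) V = 0}) ∩ (Primitive k ×ˢ NoBotRow k)) ''
    {f | (∀ q, f q ∈ Set.Icc (-K) K) ∧ f ≠ 0}

theorem finite_smallHyperplanes (k : ℕ) (K : ℤ) : (smallHyperplanes k K).Finite := by
  refine Set.Finite.image _ (Set.Finite.subset
    (Set.Finite.pi' fun _ => Set.finite_Icc (-K) K) fun f hf => hf.1)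

theorem isPairHyperplane_of_mem {K : ℤ} {H : Set (Mat k × Mat k)}
    (hH : H ∈ smallHyperplanes k K) : IsPairHyperplane k H := by
  obtain ⟨f, ⟨-, hf⟩, rfl⟩ := hH
  refine ⟨_, ⟨fun q => (f q : ℝ), fun h0 => hf ?_, rfl⟩, rfl⟩
  funext q
  exact Int.cast_eq_zero.1 (congrFun h0 q)

theorem genericPair_of_notMem {K : ℤ} {A B : Mat k} (hA : A ∈ Primitive k) (hB : B ∈ NoBotRow k)
    (h : (A, B) ∉ ⋃₀ smallHyperplanes k K) : GenericPair K A B := by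
  intro f hf hbot hsum
  by_contra hne
  refine h ⟨_, ⟨f, ⟨fun q => abs_le.1 (hf q), fun h0 => hne fun q => congrFun h0 q⟩, rfl⟩,
    ?_, hA, hB⟩
  have h1 : ∀ q, (f q : ℝ) ≠ 0 → pairEntries (A, B) q ≠ ⊥ := fun q hq =>
    hbot q (by exact_mod_cast hq)
  change linForm _ _ = 0
  rw [linForm, if_pos h1, ← WithBot.coe_zero, WithBot.coe_inj]
  refine Eq.trans ?_ hsum
  rw [Finset.sum_filter_of_ne]
  intro q _ hq h0
  exact hq (by rw [h0, zero_mul])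

instance : BorelSpace Rmax := ⟨rfl⟩

section Random

variable {Ω : Type u} [MeasurableSpace Ω] {P : Measure Ω} {X : ℕ → Ω → Mat k}

/-- The event of rank one contains the event that the sequence spells the given word. Monotonicity
of the outer measure suffices, so measurability of the event of rank one is not needed. -/
theorem hasMLP_of_word {w : ℕ → Mat k} {N : ℕ} (hN : 1 ≤ N) (hw : IsRankOne (backProd w N))
    (hpos : 0 < P {ω | ∀ i ∈ Finset.Icc 1 N, X i ω = w i}) : HasMLP X P := by
  refine ⟨N, hN, hpos.trans_le (measure_mono fun ω hω => ?_)⟩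
  change IsRankOne _
  rwa [backProd_congr (fun i hi => hω i hi)]

theorem IsIIDSeq.measure_word_pos [IsProbabilityMeasure P] (hX : IsIIDSeq X P) {A B : Mat k}
    (hA : 0 < P {ω | X 1 ω = A}) (hB : 0 < P {ω | X 1 ω = B}) (N : ℕ) {w : ℕ → Mat k}
    (hw : ∀ i, w i = A ∨ w i = B) : 0 < P {ω | ∀ i ∈ Finset.Icc 1 N, X i ω = w i} := by
  have hlaw : ∀ i C, P {ω | X i ω = C} = P {ω | X 1 ω = C} := fun i C =>
    ((hX.identDistrib i).trans (hX.identDistrib 1).symm).measure_mem_eq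
      (measurableSet_singleton C)
  have hset : {ω | ∀ i ∈ Finset.Icc 1 N, X i ω = w i} =
      ⋂ i ∈ Finset.Icc 1 N, X i ⁻¹' {w i} := by
    ext ω
    simp
  rw [hset, hX.indep.measure_inter_preimage_eq_mul (Finset.Icc 1 N)
    fun i _ => measurableSet_singleton (w i)]
  refine pos_iff_ne_zero.2 (Finset.prod_ne_zero_iff.2 fun i _ => ?_)
  have h1 : P (X i ⁻¹' {w i}) = P {ω | X 1 ω = w i} := hlaw i (w i)
  rw [h1]
  rcases hw i with h | h <;> rw [h]
  · exact hA.ne'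
  · exact hB.ne'

end Random

end MaxPlus

theorem theorem2 (k : ℕ) (hk : 1 ≤ k) :
    ∃ 𝓗 : Set (Set (MaxPlus.Mat k × MaxPlus.Mat k)),
      𝓗.Finite ∧ (∀ H ∈ 𝓗, MaxPlus.IsPairHyperplane k H) ∧
      {p : MaxPlus.Mat k × MaxPlus.Mat k |
          p ∈ MaxPlus.Primitive k ×ˢ MaxPlus.NoBotRow k ∧
          ∃ (Ω : Type u) (_ : MeasurableSpace Ω) (P : Measure Ω)
            (X : ℕ → Ω → MaxPlus.Mat k),
            IsProbabilityMeasure P ∧ MaxPlus.IsIIDSeq X P ∧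
            0 < P {ω | X 1 ω = p.1} ∧ 0 < P {ω | X 1 ω = p.2} ∧
            ¬ MaxPlus.HasMLP X P} ⊆ ⋃₀ 𝓗 ∧
      ∀ A ∈ MaxPlus.Primitive k, ∀ B ∈ MaxPlus.NoBotRow k, (A, B) ∉ ⋃₀ 𝓗 →
        ∀ (Ω : Type u) (_ : MeasurableSpace Ω) (P : Measure Ω)
          (X : ℕ → Ω → MaxPlus.Mat k),
          IsProbabilityMeasure P → MaxPlus.IsStationarySeq X P →
          (∀ (N : ℕ) (w : ℕ → MaxPlus.Mat k),
            (∀ i ∈ Finset.Icc 1 N, w i = A ∨ w i = B) →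
              0 < P {ω | ∀ i ∈ Finset.Icc 1 N, X i ω = w i}) →
          MaxPlus.HasMLP X P := by
  refine ⟨MaxPlus.smallHyperplanes k (8 * k ^ 2), MaxPlus.finite_smallHyperplanes k _,
    fun H hH => MaxPlus.isPairHyperplane_of_mem hH, ?_, ?_⟩
  · rintro ⟨A, B⟩ ⟨⟨hA, hB⟩, Ω, _, P, X, _, hX, hXA, hXB, hmlp⟩
    by_contra hAB
    obtain ⟨N, w, hN, hw, hrank⟩ := MaxPlus.exists_word_isRankOne hk hA hB
      (MaxPlus.genericPair_of_notMem hA hB hAB)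
    exact hmlp (MaxPlus.hasMLP_of_word hN hrank (hX.measure_word_pos hXA hXB N hw))
  · intro A hA B hB hAB Ω _ P X _ _ hpos
    obtain ⟨N, w, hN, hw, hrank⟩ := MaxPlus.exists_word_isRankOne hk hA hB
      (MaxPlus.genericPair_of_notMem hA hB hAB)
    exact MaxPlus.hasMLP_of_word hN hrank (hpos N w fun i _ => hw i)
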